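/- \textbf{Theorem.} (i) Let $X$ be a complex Banach space with a Schauder basis $(e_m)_{m\ge1}$ that is normalized ($\|e_m\|=1$), 1-unconditional ($\|\sum \varepsilon_m a_m e_m\|=\|\sum a_m e_m\|$ for all finite sums and all signs $\varepsilon_m=\pm1$) and non-symmetric (for some permutation $\sigma$ of $\mathbb N$, $(e_{\sigma(m)})_m$ is not equivalent to $(e_m)_m$, where two sequences $(x_m),(y_m)$ are equivalent if $\sum a_mx_m$ and $\sum a_my_m$ converge for the same scalar sequences $(a_m)$). Order $X$ by $x=\sum a_me_m\ge0 :\Leftrightarrow a_m\ge 0$ for all $m$. Then there is a sectorial operator $A$ on $X$ with sectorial angle $\omega(A)=0$ which is not $\mathcal R$-sectorial and such that $-A$ generates a positive analytic $C_0$-semigroup on $X$. Moreover, $A$ can be chosen as a Schauder multiplier $$D(A)=\Big\{\sum_m a_mf_m:\ \sum_m\gamma_ma_mf_m\text{ converges}\Big\},\qquad A\Big(\sum_m a_mf_m\Big)=\sum_m\gamma_ma_mf_m,$$ where $\gamma_m>0$ and $(f_m)$ is a Schauder basis of $X$ which, for some permutation $\pi$ of the even numbers, is given either by $f_m=e_m$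 ($m$ odd), $f_m=e_{m-1}+e_{\pi(m)}$ ($m$ even), or by $f_m=e_m+e_{\pi(m+1)}$ ($m$ odd), $f_m=e_{\pi(m)}$ ($m$ even). (ii) Let $p,q\in(1,\infty)$, $p\ne q$. In every enumeration the standard unit vectors of $\ell_p(\ell_q)$ form a normalized, non-symmetric, 1-unconditional Schauder basis inducing the natural order, and there is an operator $A$ on $\ell_p(\ell_q)$ as in (i) such that the positive analytic $C_0$-semigroup $(T(t))_{t\ge0}$ generated by $-A$ does not have maximal regularity, i.e. for no $\tau>0$ and $r\in(1,\infty)$ does $u(t)=\int_0^tT(t-s)f(s)\,ds$ belong to $W^1_r([0,\tau];X)\cap L_r([0,\tau];D(A))$, where $X=\ell_p(\ell_q)$, for all $f\in L_r([0,\tau];X)$. Here, with $\Sigma_\omega=\{z\in\mathbb C\setminus\{0\}:|\arg z|<\omega\}$ and $R(\lambda,A)=(\lambda-A)^{-1}$, a densely defined $A$ is sectorial if for some $\omega\in(0,\pi)$ one has $\sigma(A)\subset\overline{\Sigma_\omega}$ and $\sup_{\lambda\notin\overline{\Sigma_{\omega+\epsilon}}}\|\lambda R(\lambda,A)\|<\infty$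 for all $\epsilon>0$; $\omega(A)$ is the infimum of such $\omega$. It is $\mathcal R$-sectorial if moreover, for some $\omega\in(\omega(A),\pi)$, the family $\{\lambda R(\lambda,A):\lambda\notin\overline{\Sigma_\omega}\}$ is $\mathcal R$-bounded. A family $\mathcal T$ of bounded operators is $\mathcal R$-bounded if there is $C\ge0$ with $\|\sum_{k=1}^n r_kT_kx_k\|_{L_2([0,1];X)}\le C\|\sum_{k=1}^n r_kx_k\|_{L_2([0,1];X)}$ for all $n$, $T_k\in\mathcal T$, $x_k\in X$, where $r_k(t)=\operatorname{sign}\sin(2^k\pi t)$. -/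

import Mathlib

open Filter Topology MeasureTheory
open scoped ENNReal NNReal ComplexOrder

namespace PositiveMR

section SchauderBases

variable {X : Type*} [NormedAddCommGroup X] [NormedSpace ℂ X]

/-- The series `∑ xₙ` converges, in the sense of convergence of its partial sums in the given
order. -/
def SeriesConverges (x : ℕ → X) : Prop :=
  Summable x (SummationFilter.conditional ℕ)

/-- Two sequences in `X` are equivalent if the series `∑ aₙ xₙ` and `∑ aₙ yₙ` converge for the
same scalar sequences `a`. -/
def EquivalentSeq (x y : ℕ → X) : Prop :=
  ∀ a : ℕ → ℂ, SeriesConverges (fun n ↦ a n • x n) ↔ SeriesConverges (fun n ↦ a n • y n)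

/-- The basis vectors have norm one. -/
def IsNormalized (e : SchauderBasis ℂ X) : Prop := ∀ n, ‖e n‖ = 1

/-- A basis is `1`-unconditional if changing signs of coefficients does not change norms. -/
def IsOneUnconditional (e : SchauderBasis ℂ X) : Prop :=
  ∀ (s : Finset ℕ) (a : ℕ → ℂ) (ε : ℕ → ℂ), (∀ n, ε n = 1 ∨ ε n = -1) →
    ‖∑ n ∈ s, (ε n * a n) • e n‖ = ‖∑ n ∈ s, a n • e n‖

/-- A basis is symmetric if it is equivalent to each of its permutations. -/
def IsSymmetricBasis (e : SchauderBasis ℂ X) : Prop :=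
  ∀ σ : Equiv.Perm ℕ, EquivalentSeq (fun n ↦ e (σ n)) e

/-- The positive cone of the order induced by a basis: all coordinates are real and nonnegative. -/
def basisCone (e : SchauderBasis ℂ X) : Set X := {x | ∀ n, 0 ≤ e.coord n x}

/-- `f` is one of the two perturbations of the basis `e` given by a permutation of every second
basis vector. As indexing starts at `0`, the vectors with odd number (counted from `1`) are the
`e (2 * k)`, those with even number are the `e (2 * k + 1)`, and the permutation of the even
numbers is `2 * k + 1 ↦ 2 * σ k + 1`. -/
def IsPerturbedBasis (e f : SchauderBasis ℂ X) : Prop :=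
  ∃ σ : Equiv.Perm ℕ,
    (∀ k, f (2 * k) = e (2 * k) ∧ f (2 * k + 1) = e (2 * k) + e (2 * σ k + 1)) ∨
    (∀ k, f (2 * k) = e (2 * k) + e (2 * σ k + 1) ∧ f (2 * k + 1) = e (2 * σ k + 1))

/-- `A` is the (in general unbounded) Schauder multiplier of the real sequence `γ` with respect to
the basis `f`: `x = ∑ aₘ fₘ` is in the domain iff `∑ γₘ aₘ fₘ` converges, and this is then `A x`. -/
def IsSchauderMultiplier (f : SchauderBasis ℂ X) (γ : ℕ → ℝ) (A : X →ₗ.[ℂ] X) : Prop :=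
  ∀ x y : X, (x, y) ∈ A.graph ↔
    HasSum (fun m ↦ ((γ m : ℂ) * f.coord m x) • f m) y (SummationFilter.conditional ℕ)

end SchauderBases

section Sectorial

variable {X : Type*} [NormedAddCommGroup X] [NormedSpace ℂ X]

/-- The open sector of half-angle `ω` around the positive real axis. -/
def sector (ω : ℝ) : Set ℂ := {z | z ≠ 0 ∧ |z.arg| < ω}

/-- `R` is the bounded two-sided inverse of `z - A`, that is `R = R(z, A)`. -/
def IsResolventAt (A : X →ₗ.[ℂ] X) (z : ℂ) (R : X →L[ℂ] X) : Prop :=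
  (∀ y : X, ∃ h : R y ∈ A.domain, z • R y - A ⟨R y, h⟩ = y) ∧
    ∀ x : A.domain, R (z • (x : X) - A x) = x

/-- The spectrum of a possibly unbounded operator. -/
def opSpectrum (A : X →ₗ.[ℂ] X) : Set ℂ := {z | ¬ ∃ R, IsResolventAt A z R}

/-- The condition `(S_ω)`: the spectrum lies in the closed sector, and `z R(z, A)` is bounded
outside each strictly larger closed sector. -/
def SectorialCondition (A : X →ₗ.[ℂ] X) (ω : ℝ) : Prop :=
  opSpectrum A ⊆ closure (sector ω) ∧
    ∀ ε > 0, ∃ C : ℝ, ∀ z ∉ closure (sector (ω + ε)), ∀ R, IsResolventAt A z R → ‖z • R‖ ≤ C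

/-- Sectorial operators. -/
def IsSectorial (A : X →ₗ.[ℂ] X) : Prop :=
  Dense (A.domain : Set X) ∧ ∃ ω ∈ Set.Ioo 0 Real.pi, SectorialCondition A ω

/-- The sectorial angle `ω(A)` of a sectorial operator. -/
noncomputable def sectorialAngle (A : X →ₗ.[ℂ] X) : ℝ :=
  sInf {ω | ω ∈ Set.Ioo 0 Real.pi ∧ SectorialCondition A ω}

/-- The Rademacher functions `r_k(t) = sign (sin (2 ^ k π t))`. -/
noncomputable def rademacher (k : ℕ) (t : ℝ) : ℝ := Real.sign (Real.sin (2 ^ k * Real.pi * t))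

/-- The norm of `∑_{k = 1}^n r_k x_k` in `L₂([0, 1]; X)`. -/
noncomputable def rademacherNorm {n : ℕ} (x : Fin n → X) : ℝ≥0∞ :=
  eLpNorm (fun t : ℝ ↦ ∑ k : Fin n, (rademacher ((k : ℕ) + 1) t : ℂ) • x k) 2
    (volume.restrict (Set.Icc 0 1))

/-- `R`-boundedness of a family of bounded operators. -/
def IsRBounded (𝒯 : Set (X →L[ℂ] X)) : Prop :=
  ∃ C : ℝ≥0, ∀ (n : ℕ) (T : Fin n → X →L[ℂ] X) (x : Fin n → X), (∀ k, T k ∈ 𝒯) →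
    rademacherNorm (fun k ↦ T k (x k)) ≤ C * rademacherNorm x

/-- `R`-sectorial operators. The angle is required to be less than `π`, as otherwise no `z` lies
outside the sector. -/
def IsRSectorial (A : X →ₗ.[ℂ] X) : Prop :=
  IsSectorial A ∧ ∃ ω, sectorialAngle A < ω ∧ ω < Real.pi ∧
    IsRBounded {S | ∃ z ∉ closure (sector ω), ∃ R, IsResolventAt A z R ∧ S = z • R}

end Sectorial

section Semigroups

variable {X : Type*} [NormedAddCommGroup X] [NormedSpace ℂ X]

/-- `(T t)_{t ≥ 0}` is a strongly continuous semigroup. Values at `t < 0` are irrelevant. -/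
structure IsC0Semigroup (T : ℝ → X →L[ℂ] X) : Prop where
  map_zero : T 0 = ContinuousLinearMap.id ℂ X
  map_add : ∀ s t, 0 ≤ s → 0 ≤ t → T (s + t) = (T s).comp (T t)
  tendsto_zero : ∀ x, Tendsto (fun t ↦ T t x) (𝓝[>] 0) (𝓝 x)

/-- The operator `B` is the generator of the semigroup `T`. -/
def IsGeneratorOf (B : X →ₗ.[ℂ] X) (T : ℝ → X →L[ℂ] X) : Prop :=
  ∀ x y : X, (x, y) ∈ B.graph ↔
    Tendsto (fun t : ℝ ↦ ((t⁻¹ : ℝ) : ℂ) • (T t x - x)) (𝓝[>] 0) (𝓝 y)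

/-- `T` is an analytic `C₀`-semigroup: it extends to a semigroup that is analytic on a sector and
strongly continuous at `0` on each smaller sector. -/
def IsAnalyticC0Semigroup (T : ℝ → X →L[ℂ] X) : Prop :=
  IsC0Semigroup T ∧ ∃ θ ∈ Set.Ioc 0 (Real.pi / 2), ∃ S : ℂ → X →L[ℂ] X,
    (∀ t : ℝ, 0 ≤ t → S t = T t) ∧
    (∀ z ∈ sector θ, ∀ w ∈ sector θ, S (z + w) = (S z).comp (S w)) ∧
    DifferentiableOn ℂ S (sector θ) ∧
    ∀ θ' ∈ Set.Ioo 0 θ, ∀ x, Tendsto (fun z ↦ S z x) (𝓝[sector θ'] 0) (𝓝 x)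

/-- The semigroup leaves the positive cone `K` invariant. -/
def IsPositiveSemigroup (K : Set X) (T : ℝ → X →L[ℂ] X) : Prop :=
  ∀ t, 0 ≤ t → ∀ x ∈ K, T t x ∈ K

/-- The mild solution of `u' + A u = f`, `u(0) = 0`, for the semigroup `T` generated by `-A`. -/
noncomputable def mildSolution (T : ℝ → X →L[ℂ] X) (f : ℝ → X) (t : ℝ) : X :=
  ∫ s in (0 : ℝ)..t, T (t - s) (f s)

/-- Membership in the Bochner-Sobolev space `W^1_r([0, τ]; X)`: the function and its weak derivative
are in `L_r`. -/
def MemW1 (u : ℝ → X) (r : ℝ≥0∞) (τ : ℝ) : Prop :=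
  MemLp u r (volume.restrict (Set.Icc 0 τ)) ∧
    ∃ g : ℝ → X, MemLp g r (volume.restrict (Set.Icc 0 τ)) ∧
      ∀ φ : ℝ → ℝ, ContDiff ℝ ((⊤ : ℕ∞) : WithTop ℕ∞) φ → HasCompactSupport φ → tsupport φ ⊆ Set.Ioo 0 τ →
        ∫ t in Set.Icc 0 τ, ((deriv φ t : ℝ) : ℂ) • u t
          = -∫ t in Set.Icc 0 τ, ((φ t : ℝ) : ℂ) • g t

/-- Membership in `L_r([0, τ]; D(A))`, where `D(A)` carries the graph norm. -/
def MemLpDomain (A : X →ₗ.[ℂ] X) (u : ℝ → X) (r : ℝ≥0∞) (τ : ℝ) : Prop :=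
  MemLp u r (volume.restrict (Set.Icc 0 τ)) ∧
    ∃ v : ℝ → X, MemLp v r (volume.restrict (Set.Icc 0 τ)) ∧
      ∀ᵐ t ∂(volume.restrict (Set.Icc 0 τ)), (u t, v t) ∈ A.graph

/-- Maximal regularity of `-A`, the generator of `T`: for some choice of the time `τ > 0` and of the
exponent `r ∈ (1, ∞)`, all mild solutions with right-hand side in `L_r` have the best possible
regularity. The property does not depend on the choice of `τ` and `r`; with existential quantifiers
its negation is the failure for every choice. -/
def HasMaximalRegularity (A : X →ₗ.[ℂ] X) (T : ℝ → X →L[ℂ] X) : Prop :=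
  ∃ τ : ℝ, 0 < τ ∧ ∃ r : ℝ≥0∞, 1 < r ∧ r < ∞ ∧
    ∀ f : ℝ → X, MemLp f r (volume.restrict (Set.Icc 0 τ)) →
      MemW1 (mildSolution T f) r τ ∧ MemLpDomain A (mildSolution T f) r τ

end Semigroups

section MixedSpaces

/-- The complex Banach space `ℓ_p(ℓ_q)`. -/
abbrev MixedLp (p q : ℝ≥0∞) [Fact (1 ≤ p)] [Fact (1 ≤ q)] : Type :=
  lp (fun _ : ℕ ↦ lp (fun _ : ℕ ↦ ℂ) q) p

/-- The standard unit vectors of `ℓ_p(ℓ_q)`. -/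
noncomputable def mixedUnit (p q : ℝ≥0∞) [Fact (1 ≤ p)] [Fact (1 ≤ q)] (ij : ℕ × ℕ) :
    MixedLp p q :=
  lp.single p ij.1 (lp.single q ij.2 (1 : ℂ))

/-- The positive cone of the natural (entrywise) lattice order of `ℓ_p(ℓ_q)`. -/
def mixedCone (p q : ℝ≥0∞) [Fact (1 ≤ p)] [Fact (1 ≤ q)] : Set (MixedLp p q) :=
  {x | ∀ i j, 0 ≤ x i j}

end MixedSpaces

end PositiveMR

open PositiveMR

/-!
Non-symmetry of `e` yields a permutation `σ` such that the even part `e (2 * k)` and the permuted odd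
part `e (2 * σ k + 1)` are not equivalent (`exists_perm_not_equivalent`). Call the two sequences
`e (u k)` and `e (v k)`, in the order for which some series `∑ c k • e (v k)` converges while
`∑ c k • e (u k)` diverges, and replace each pair `e (u k)`, `e (v k)` by `e (u k)`,
`e (u k) + e (v k)` (`perturbedBasis`). Let `A` be the multiplier with the exponent `2 * 4 ^ k` at
`e (u k)` and `4 ^ k` at `e (u k) + e (v k)`.

In the coordinates of `e`, a multiplier of the new basis is block diagonal with triangular two by two
blocks. Its diagonal part is bounded by unconditionality; its off-diagonal part is an absolutely
convergent series of rank one operators as soon as the differences of the symbol over the pairs are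
summable (`hasPairMultipliers_perturbedBasis`). For the symbols of the resolvents, of the semigroup on
sectors and of the difference quotients of the semigroup, these differences are dominated by
`s / (1 + s) ^ 2` along a geometric progression, whose sum is bounded uniformly in the parameter
(`sum_geometric_decay_le`). Hence `A` is sectorial of angle zero and `-A` generates an analytic
semigroup. The semigroup is positive because its off-diagonal entries
`exp (-4 ^ k t) - exp (-2 * 4 ^ k t)` are.

At `z = -4 ^ k` the operator `z R(z, A)` maps `e (v k)` to `e (v k) / 2 + e (u k) / 6`. Rademacher sums
of multiples of basis vectors have the norm of the plain sum, so R-sectoriality would bound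
`∑ c k • e (u k)` by `∑ c k • e (v k)`, contradicting the choice of `c` (`not_isRSectorial`). In the
same way, the response of the Cauchy problem to the forcing term `∑ c k * exp (i 4 ^ k s) • e (v k)`,
which is bounded in `X`, has after application of `A` a coefficient at `e (u k)` comparable to `c k`; so
the mild solution is outside the domain of `A` at every positive time, and no abstract
characterization of maximal regularity is needed (`not_hasMaximalRegularity`).

In `ℓ_p(ℓ_q)` the transposition of indices exchanges a copy of `ℓ_q` and a copy of `ℓ_p`, so the unit
vector basis is not symmetric for `p ≠ q` (`not_isSymmetricBasis_mixedBasis`).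
-/

namespace PositiveMR

/-! ### Unconditional bases -/

section Unconditional

theorem hasSum_conditional_iff {X : Type*} [AddCommMonoid X] [TopologicalSpace X] {x : ℕ → X}
    {y : X} :
    HasSum x y (SummationFilter.conditional ℕ) ↔
      Tendsto (fun n ↦ ∑ i ∈ Finset.range n, x i) atTop (𝓝 y) := by
  rw [HasSum, SummationFilter.conditional_filter_eq_map_range, tendsto_map'_iff]
  rfl

theorem hasSum_conditional_of_hasSum {X : Type*} [AddCommMonoid X] [TopologicalSpace X]
    {x : ℕ → X} {y : X} (h : HasSum x y) :
    HasSum x y (SummationFilter.conditional ℕ) :=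
  hasSum_conditional_iff.2 h.tendsto_sum_nat

variable {X : Type*} [NormedAddCommGroup X] [NormedSpace ℂ X]

theorem coord_self (e : SchauderBasis ℂ X) (n : ℕ) : e.coord n (e n) = 1 := by
  simp [e.ortho]

theorem coord_ne (e : SchauderBasis ℂ X) {n m : ℕ} (h : n ≠ m) : e.coord n (e m) = 0 := by
  simp [e.ortho, h]

theorem ext_coord (e : SchauderBasis ℂ X) {x y : X} (h : ∀ n, e.coord n x = e.coord n y) :
    x = y := by
  have hx := hasSum_conditional_iff.1 (e.expansion x)
  have hy := hasSum_conditional_iff.1 (e.expansion y)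
  simp only [h] at hx
  exact tendsto_nhds_unique hx hy

theorem coord_of_hasSum (e : SchauderBasis ℂ X) {a : ℕ → ℂ} {x : X}
    (h : HasSum (fun n ↦ a n • e n) x (SummationFilter.conditional ℕ)) (n : ℕ) :
    e.coord n x = a n := by
  have h1 := ((e.coord n).continuous.tendsto x).comp (hasSum_conditional_iff.1 h)
  refine tendsto_nhds_unique h1 (tendsto_const_nhds.congr' ?_)
  filter_upwards [eventually_gt_atTop n] with N hN
  simp [map_sum, e.ortho, Pi.single_apply, hN]

theorem tendsto_coord_smul (e : SchauderBasis ℂ X) (x : X) :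
    Tendsto (fun n ↦ e.coord n x • e n) atTop (𝓝 0) := by
  have h := hasSum_conditional_iff.1 (e.expansion x)
  have := (h.comp (tendsto_add_atTop_nat 1)).sub h
  simpa [Function.comp_def, Finset.sum_range_succ] using this

variable {e : SchauderBasis ℂ X}

/-- Multiplying coefficients by real numbers of modulus at most one is a contraction, because
such multipliers are convex combinations of sign changes. -/
theorem norm_sum_ofReal_mul_le (he : IsOneUnconditional e) (s : Finset ℕ) (a : ℕ → ℂ) (w : ℕ → ℝ)
    (hw : ∀ n, |w n| ≤ 1) : ‖∑ n ∈ s, ((w n : ℂ) * a n) • e n‖ ≤ ‖∑ n ∈ s, a n • e n‖ := by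
  -- The multiplier is changed from signs to arbitrary values one coordinate at a time.
  have key : ∀ t : Finset ℕ, ∀ w : ℕ → ℝ, (∀ n, |w n| ≤ 1) → (∀ n ∉ t, w n = 1 ∨ w n = -1) →
      ‖∑ n ∈ s, ((w n : ℂ) * a n) • e n‖ ≤ ‖∑ n ∈ s, a n • e n‖ := by
    intro t
    induction t using Finset.induction_on with
    | empty =>
      intro w _ hw2
      refine (he s a (fun n ↦ (w n : ℂ)) fun n ↦ ?_).le
      rcases hw2 n (by simp) with h | h <;> simp [h]
    | insert m t hm ih =>
      intro w hw1 hw2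
      have h1 := ih (Function.update w m 1) (fun n ↦ by
          by_cases h : n = m <;> simp [h, hw1])
        (fun n hn ↦ by
          by_cases h : n = m
          · simp [h]
          · simpa [Function.update_apply, h] using hw2 n (by simp [h, hn]))
      have h2 := ih (Function.update w m (-1)) (fun n ↦ by
          by_cases h : n = m <;> simp [h, hw1])
        (fun n hn ↦ by
          by_cases h : n = m
          · simp [h]
          · simpa [Function.update_apply, h] using hw2 n (by simp [h, hn]))
      have hm1 := abs_le.1 (hw1 m)
      have hid : ∑ n ∈ s, ((w n : ℂ) * a n) • e n =
          (((1 + w m) / 2 : ℝ) : ℂ) • ∑ n ∈ s, ((Function.update w m 1 n : ℂ) * a n) • e n +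
          (((1 - w m) / 2 : ℝ) : ℂ) •
            ∑ n ∈ s, ((Function.update w m (-1) n : ℂ) * a n) • e n := by
        rw [Finset.smul_sum, Finset.smul_sum, ← Finset.sum_add_distrib]
        refine Finset.sum_congr rfl fun n _ ↦ ?_
        rw [smul_smul, smul_smul, ← add_smul]
        congr 1
        by_cases h : n = m
        · subst h; simp; ring
        · simp [h]; ring
      rw [hid]
      refine (norm_add_le _ _).trans ?_
      rw [norm_smul, norm_smul, Complex.norm_real, Complex.norm_real,
        Real.norm_of_nonneg (by linarith), Real.norm_of_nonneg (by linarith)]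
      nlinarith
  have := key s (fun n ↦ if n ∈ s then w n else 1)
    (fun n ↦ by by_cases h : n ∈ s <;> simp [h, hw]) (fun n hn ↦ by simp [hn])
  convert this using 2
  exact Finset.sum_congr rfl fun n hn ↦ by simp [hn]

/-- Complex multipliers are split into their real and imaginary parts, which costs a factor two. -/
theorem norm_sum_mul_le (he : IsOneUnconditional e) (s : Finset ℕ) (a w : ℕ → ℂ)
    {B : ℝ} (hB : 0 < B) (hw : ∀ n, ‖w n‖ ≤ B) :
    ‖∑ n ∈ s, (w n * a n) • e n‖ ≤ 2 * B * ‖∑ n ∈ s, a n • e n‖ := by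
  have hre := norm_sum_ofReal_mul_le he s a (fun n ↦ (w n).re / B) (fun n ↦ by
    rw [abs_div, abs_of_pos hB, div_le_one hB]
    exact (Complex.abs_re_le_norm _).trans (hw n))
  have him := norm_sum_ofReal_mul_le he s a (fun n ↦ (w n).im / B) (fun n ↦ by
    rw [abs_div, abs_of_pos hB, div_le_one hB]
    exact (Complex.abs_im_le_norm _).trans (hw n))
  have hid : ∑ n ∈ s, (w n * a n) • e n =
      (B : ℂ) • ∑ n ∈ s, ((((w n).re / B : ℝ) : ℂ) * a n) • e n +
      (B * Complex.I) • ∑ n ∈ s, ((((w n).im / B : ℝ) : ℂ) * a n) • e n := by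
    rw [Finset.smul_sum, Finset.smul_sum, ← Finset.sum_add_distrib]
    refine Finset.sum_congr rfl fun n _ ↦ ?_
    rw [smul_smul, smul_smul, ← add_smul]
    congr 1
    have hB' : (B : ℂ) ≠ 0 := by exact_mod_cast hB.ne'
    push_cast
    field_simp
    conv_lhs => rw [← Complex.re_add_im (w n)]
    ring
  rw [hid]
  refine (norm_add_le _ _).trans ?_
  rw [norm_smul, norm_smul, norm_mul, Complex.norm_I, Complex.norm_real, Real.norm_of_nonneg hB.le]
  nlinarith

theorem norm_sum_le_of_subset (he : IsOneUnconditional e) {s t : Finset ℕ} (h : s ⊆ t)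
    (a : ℕ → ℂ) : ‖∑ n ∈ s, a n • e n‖ ≤ ‖∑ n ∈ t, a n • e n‖ := by
  have := norm_sum_ofReal_mul_le he t a (fun n ↦ if n ∈ s then 1 else 0)
    (fun n ↦ by by_cases h : n ∈ s <;> simp [h])
  refine le_trans (le_of_eq ?_) this
  congr 1
  rw [← Finset.sum_subset h (f := fun n ↦ (((if n ∈ s then (1 : ℝ) else 0) : ℝ) * a n : ℂ) • e n)]
  · exact Finset.sum_congr rfl fun n hn ↦ by simp [hn]
  · intro n _ hn; simp [hn]

theorem summable_of_seriesConverges [CompleteSpace X] (he : IsOneUnconditional e) {a : ℕ → ℂ}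
    (h : SeriesConverges fun n ↦ a n • e n) : Summable fun n ↦ a n • e n := by
  obtain ⟨y, hy⟩ := h
  have hc := (hasSum_conditional_iff.1 hy).cauchySeq
  rw [summable_iff_vanishing_norm]
  intro ε hε
  obtain ⟨N, hN⟩ := Metric.cauchySeq_iff'.1 hc ε hε
  refine ⟨Finset.range N, fun t ht ↦ ?_⟩
  obtain ⟨M, hM⟩ := t.exists_nat_subset_range
  have hsub : t ⊆ Finset.Ico N (max N M) := fun i hi ↦ by
    have h1 : i ∉ Finset.range N := Finset.disjoint_left.1 ht hi
    have h2 := Finset.mem_range.1 (hM hi)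
    simp only [Finset.mem_range, not_lt] at h1
    simp [h1, h2]
  refine (norm_sum_le_of_subset he hsub a).trans_lt ?_
  have := hN (max N M) (le_max_left _ _)
  rwa [dist_eq_norm, ← Finset.sum_Ico_eq_sub _ (le_max_left N M)] at this

theorem hasSum_expansion [CompleteSpace X] (he : IsOneUnconditional e) (x : X) :
    HasSum (fun n ↦ e.coord n x • e n) x := by
  have h := (summable_of_seriesConverges he ⟨x, e.expansion x⟩).hasSum
  have := tendsto_nhds_unique h.tendsto_sum_nat (hasSum_conditional_iff.1 (e.expansion x))
  rwa [this] at h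

/-- A scalar sequence has a convergent series along an unconditional basis if and only if it is the
coordinate sequence of a vector. -/
theorem summable_iff_exists_coord [CompleteSpace X] (he : IsOneUnconditional e) {a : ℕ → ℂ} :
    (Summable fun n ↦ a n • e n) ↔ ∃ x, ∀ n, e.coord n x = a n := by
  constructor
  · rintro ⟨x, hx⟩
    exact ⟨x, coord_of_hasSum e (hasSum_conditional_of_hasSum hx)⟩
  · rintro ⟨x, hx⟩
    simpa only [hx] using (hasSum_expansion he x).summable

theorem norm_sum_coord_le [CompleteSpace X] (he : IsOneUnconditional e) (s : Finset ℕ) (x : X) :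
    ‖∑ n ∈ s, e.coord n x • e n‖ ≤ ‖x‖ :=
  ge_of_tendsto (hasSum_expansion he x).norm (by
    filter_upwards [eventually_ge_atTop s] with t ht using norm_sum_le_of_subset he ht _)

theorem norm_coord_le [CompleteSpace X] (he : IsOneUnconditional e) (hn : IsNormalized e) (n : ℕ)
    (x : X) : ‖e.coord n x‖ ≤ ‖x‖ := by
  simpa [norm_smul, hn n] using norm_sum_coord_le he {n} x

/-- Bounded sequences act as diagonal operators with respect to an unconditional basis. -/
theorem exists_diagonal [CompleteSpace X] (he : IsOneUnconditional e) (w : ℕ → ℂ) {B : ℝ}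
    (hw : ∀ n, ‖w n‖ ≤ B) :
    ∃ D : X →L[ℂ] X, (∀ n x, e.coord n (D x) = w n * e.coord n x) ∧ ‖D‖ ≤ 2 * B := by
  have hB0 : 0 ≤ B := (norm_nonneg _).trans (hw 0)
  have hsum : ∀ x, ∃ y, ∀ n, e.coord n y = w n * e.coord n x := by
    intro x
    rw [← summable_iff_exists_coord he, summable_iff_vanishing_norm]
    intro ε hε
    have hB1 : 0 < B + 1 := by linarith
    obtain ⟨s, hs⟩ := summable_iff_vanishing_norm.1 (hasSum_expansion he x).summable
      (ε / (2 * (B + 1))) (by positivity)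
    refine ⟨s, fun t ht ↦ ?_⟩
    refine (norm_sum_mul_le he t _ w hB1 fun n ↦ (hw n).trans (by linarith)).trans_lt ?_
    have := hs t ht
    rw [lt_div_iff₀ (by positivity)] at this
    linarith
  choose D hD using hsum
  have hbound : ∀ x, ‖D x‖ ≤ 2 * B * ‖x‖ := by
    intro x
    refine le_of_forall_pos_le_add fun ε hε ↦ ?_
    -- The estimate for finite sums needs a positive bound, but `B` may be zero.
    have hlim : ∀ B' > B, ‖D x‖ ≤ 2 * B' * ‖x‖ := by
      intro B' hB'
      refine le_of_tendsto (hasSum_expansion he (D x)).norm (Eventually.of_forall fun s ↦ ?_)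
      simp only [hD]
      have h0 : 0 < B' := by linarith
      refine (norm_sum_mul_le he s _ w h0 fun n ↦ (hw n).trans hB'.le).trans ?_
      gcongr
      exact norm_sum_coord_le he s x
    have hpos : 0 < ε / (2 * (‖x‖ + 1)) := by positivity
    refine (hlim (B + ε / (2 * (‖x‖ + 1))) (by linarith)).trans ?_
    have h3 : 2 * (B + ε / (2 * (‖x‖ + 1))) * ‖x‖ = 2 * B * ‖x‖ + ε * (‖x‖ / (‖x‖ + 1)) := by
      field_simp
    rw [h3]
    have : ‖x‖ / (‖x‖ + 1) ≤ 1 := by rw [div_le_one (by positivity)]; linarith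
    nlinarith
  refine ⟨LinearMap.mkContinuous
    { toFun := D
      map_add' := fun x y ↦ ext_coord e fun n ↦ by simp [hD, mul_add]
      map_smul' := fun c x ↦ ext_coord e fun n ↦ by simp [hD]; ring } (2 * B) hbound,
    fun n x ↦ hD x n,
    LinearMap.mkContinuous_norm_le _ (by positivity) _⟩

theorem summable_iff_exists_coord_subseq [CompleteSpace X] (he : IsOneUnconditional e) {i : ℕ → ℕ}
    (hi : Function.Injective i) {a : ℕ → ℂ} :
    (Summable fun k ↦ a k • e (i k)) ↔ ∃ x, ∀ k, e.coord (i k) x = a k := by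
  constructor
  · rintro ⟨x, hx⟩
    refine ⟨x, fun k ↦ ?_⟩
    have h1 := (e.coord (i k)).hasSum hx
    have h2 := hasSum_single (f := fun l ↦ e.coord (i k) (a l • e (i l))) k fun l hl ↦ by
      simp [coord_ne e (hi.ne hl.symm)]
    simpa [coord_self] using h1.unique h2
  · rintro ⟨x, hx⟩
    have := (hasSum_expansion he x).summable.comp_injective hi
    simpa only [Function.comp_def, hx] using this

/-- For subsequences of an unconditional basis, the convergence of a series does not depend on the
order of summation. -/
theorem seriesConverges_subseq_iff [CompleteSpace X] (he : IsOneUnconditional e) {i : ℕ → ℕ}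
    (hi : Function.Injective i) {a : ℕ → ℂ} :
    SeriesConverges (fun k ↦ a k • e (i k)) ↔ Summable fun k ↦ a k • e (i k) := by
  refine ⟨fun ⟨y, hy⟩ ↦ ?_, fun ⟨y, hy⟩ ↦ ⟨y, hasSum_conditional_of_hasSum hy⟩⟩
  rw [summable_iff_exists_coord_subseq he hi]
  refine ⟨y, fun k ↦ ?_⟩
  have h1 := ((e.coord (i k)).continuous.tendsto y).comp (hasSum_conditional_iff.1 hy)
  refine tendsto_nhds_unique h1 (tendsto_const_nhds.congr' ?_)
  filter_upwards [eventually_gt_atTop k] with N hN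
  simp [map_sum, e.ortho, Pi.single_apply, hN, hi.eq_iff]

end Unconditional

/-! ### Non-symmetric bases -/

section NonSymmetric

/-- A bijection between two sets of natural numbers, both with infinite complement, extends to a
permutation. -/
theorem exists_perm_extending {ι : Type*} {i j : ι → ℕ} (hi : Function.Injective i)
    (hj : Function.Injective j) (hi' : (Set.range i)ᶜ.Infinite) (hj' : (Set.range j)ᶜ.Infinite) :
    ∃ σ : Equiv.Perm ℕ, ∀ n, σ (i n) = j n := by
  classical
  have := hi'.to_subtype
  have := hj'.to_subtype
  obtain ⟨g⟩ : Nonempty ({x // x ∉ Set.range i} ≃ {x // x ∉ Set.range j}) :=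
    nonempty_equiv_of_countable (α := ↥(Set.range i)ᶜ) (β := ↥(Set.range j)ᶜ)
  let h : {x // x ∈ Set.range i} ≃ {x // x ∈ Set.range j} :=
    (Equiv.ofInjective i hi).symm.trans (Equiv.ofInjective j hj)
  refine ⟨Equiv.subtypeCongr h g, fun n ↦ ?_⟩
  have hn : i n ∈ Set.range i := ⟨n, rfl⟩
  simp only [Equiv.subtypeCongr, Equiv.trans_apply, Equiv.sumCompl_symm_apply_of_pos hn, h,
    Equiv.sumCongr_apply, Sum.map_inl, Equiv.sumCompl_apply_inl]
  have : (Equiv.ofInjective i hi).symm ⟨i n, hn⟩ = n := by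
    rw [Equiv.symm_apply_eq]; rfl
  rw [this]
  rfl

theorem infinite_compl_range_half {ι : Type*} {i : ι → ℕ} {r : ℕ} (hi : ∀ n, i n % 4 = r) :
    (Set.range fun n ↦ i n / 2)ᶜ.Infinite := by
  refine Set.infinite_of_injective_forall_mem (f := fun k : ℕ ↦ 2 * k + (1 - r / 2))
    (fun a b h ↦ by simpa using h) ?_
  rintro k ⟨n, hn⟩
  have := hi n
  simp only at hn
  omega

theorem summable_iff_forall_fiber {X κ : Type*} [NormedAddCommGroup X] [CompleteSpace X]
    [Finite κ] (g : ℕ → κ) (F : ℕ → X) :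
    Summable F ↔ ∀ k, Summable fun n : {n // g n = k} ↦ F n := by
  have := Fintype.ofFinite κ
  refine ⟨fun h k ↦ h.subtype {n | g n = k}, fun h ↦ ?_⟩
  have h2 : ∀ k, Summable (Set.indicator {n | g n = k} F) := fun k ↦
    summable_subtype_iff_indicator.1 (h k)
  have h3 : F = fun n ↦ ∑ k, Set.indicator {n | g n = k} F n := by
    classical
    ext n
    simp [Set.indicator_apply]
  rw [h3]
  exact summable_sum fun k _ ↦ h2 k

variable {X : Type*} [NormedAddCommGroup X] [NormedSpace ℂ X]
  {e : SchauderBasis ℂ X}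

/-- If the even part of a basis is equivalent to each permutation of its odd part, then families
indexed by an even and by an odd residue class modulo four are equivalent. Restriction to such
classes leaves room for extending partial bijections to permutations. -/
theorem summable_iff_of_even_of_odd
    (H : ∀ (σ : Equiv.Perm ℕ) (c : ℕ → ℂ),
      (Summable fun k ↦ c k • e (2 * k)) ↔ Summable fun k ↦ c k • e (2 * σ k + 1))
    {ι : Type*} {i j : ι → ℕ} (hi : Function.Injective i) (hj : Function.Injective j) {r s : ℕ}
    (hir : ∀ n, i n % 4 = r) (hjs : ∀ n, j n % 4 = s) (hr : r % 2 = 0) (hs : s % 2 = 1)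
    (a : ι → ℂ) : (Summable fun n ↦ a n • e (i n)) ↔ Summable fun n ↦ a n • e (j n) := by
  have hi2 : Function.Injective fun n ↦ i n / 2 := fun n m h ↦ hi (by
    have := hir n; have := hir m; simp only at h; omega)
  have hj2 : Function.Injective fun n ↦ j n / 2 := fun n m h ↦ hj (by
    have := hjs n; have := hjs m; simp only at h; omega)
  obtain ⟨σ, hσ⟩ := exists_perm_extending hi2 hj2 (infinite_compl_range_half hir)
    (infinite_compl_range_half hjs)
  have h := H σ (Function.extend (fun n ↦ i n / 2) a 0)
  rw [← hi2.summable_iff, ← hi2.summable_iff] at h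
  · convert h using 2
    · ext n
      have : 2 * (i n / 2) = i n := by have := hir n; omega
      simp [this, hi2.extend_apply]
    · ext n
      have : 2 * (j n / 2) + 1 = j n := by have := hjs n; omega
      simp only [Function.comp_apply, hi2.extend_apply]
      rw [hσ n, this]
  · intro k hk
    rw [Function.extend_apply' _ _ _ (by simpa using hk)]
    simp
  · intro k hk
    rw [Function.extend_apply' _ _ _ (by simpa using hk)]
    simp

/-- Two families with indices of the same parity are compared through an auxiliary family with indices
of the other parity. -/
theorem summable_iff_of_residues
    (H : ∀ (σ : Equiv.Perm ℕ) (c : ℕ → ℂ),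
      (Summable fun k ↦ c k • e (2 * k)) ↔ Summable fun k ↦ c k • e (2 * σ k + 1))
    {ι : Type*} {i j : ι → ℕ} (hi : Function.Injective i) (hj : Function.Injective j) {r s : ℕ}
    (hir : ∀ n, i n % 4 = r) (hjs : ∀ n, j n % 4 = s)
    (a : ι → ℂ) : (Summable fun n ↦ a n • e (i n)) ↔ Summable fun n ↦ a n • e (j n) := by
  have h0 : Function.Injective fun n ↦ 4 * i n := fun n m h ↦ hi (by simp only at h; omega)
  have h1 : Function.Injective fun n ↦ 4 * i n + 1 := fun n m h ↦ hi (by simp only at h; omega)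
  rcases Nat.mod_two_eq_zero_or_one r with hr | hr <;>
    rcases Nat.mod_two_eq_zero_or_one s with hs | hs
  · exact (summable_iff_of_even_of_odd H hi h1 hir (s := 1) (fun n ↦ by omega) hr rfl a).trans
      (summable_iff_of_even_of_odd H hj h1 hjs (s := 1) (fun n ↦ by omega) hs rfl a).symm
  · exact summable_iff_of_even_of_odd H hi hj hir hjs hr hs a
  · exact (summable_iff_of_even_of_odd H hj hi hjs hir hs hr a).symm
  · exact (summable_iff_of_even_of_odd H h0 hi (r := 0) (fun n ↦ by omega) hir rfl hr a).symm.trans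
      (summable_iff_of_even_of_odd H h0 hj (r := 0) (fun n ↦ by omega) hjs rfl hs a)

/-- The even part of a non-symmetric unconditional basis fails to be equivalent to some permutation
of its odd part. -/
theorem exists_perm_not_equivalent [CompleteSpace X] (he : IsOneUnconditional e)
    (hs : ¬ IsSymmetricBasis e) :
    ∃ σ : Equiv.Perm ℕ, ¬ EquivalentSeq (fun k ↦ e (2 * k)) (fun k ↦ e (2 * σ k + 1)) := by
  by_contra! hcon
  refine hs fun τ a ↦ ?_
  have H : ∀ (σ : Equiv.Perm ℕ) (c : ℕ → ℂ),
      (Summable fun k ↦ c k • e (2 * k)) ↔ Summable fun k ↦ c k • e (2 * σ k + 1) := by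
    intro σ c
    rw [← seriesConverges_subseq_iff he (i := fun k ↦ 2 * k) (fun n m h ↦ by simpa using h),
      ← seriesConverges_subseq_iff he (i := fun k ↦ 2 * σ k + 1) (fun n m h ↦ by simpa using h)]
    exact hcon σ c
  rw [seriesConverges_subseq_iff he τ.injective,
    seriesConverges_subseq_iff he (i := fun n ↦ n) Function.injective_id]
  -- On each fiber of `g` both index maps stay in a single residue class.
  let g : ℕ → Fin 4 × Fin 4 := fun n ↦ (Fin.ofNat 4 (τ n), Fin.ofNat 4 n)
  rw [summable_iff_forall_fiber g, summable_iff_forall_fiber g]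
  refine forall_congr' fun k ↦ ?_
  refine summable_iff_of_residues H (τ.injective.comp Subtype.val_injective)
    Subtype.val_injective (r := k.1) (s := k.2) ?_ ?_ _
  · rintro ⟨n, rfl⟩
    simp [g]
  · rintro ⟨n, rfl⟩
    simp [g]

end NonSymmetric

/-! ### The perturbed basis and its multipliers -/

section Perturbation

/-- The injective index maps `u` and `v` have disjoint ranges, which together exhaust the natural
numbers. -/
structure IsSplitting (u v : ℕ → ℕ) : Prop where
  injective_left : Function.Injective u
  injective_right : Function.Injective v
  ne : ∀ k l, u k ≠ v l
  cover : ∀ n, (∃ k, u k = n) ∨ ∃ k, v k = n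

theorem sum_range_eq_pairs {X : Type*} [AddCommMonoid X] (t : ℕ → X) (n : ℕ) :
    ∑ i ∈ Finset.range n, t i = ∑ k ∈ Finset.range (n / 2), (t (2 * k) + t (2 * k + 1)) +
      if n % 2 = 1 then t (n - 1) else 0 := by
  have h2 : ∀ K, ∑ i ∈ Finset.range (2 * K), t i =
      ∑ k ∈ Finset.range K, (t (2 * k) + t (2 * k + 1)) := by
    intro K
    induction K with
    | zero => simp
    | succ K ih =>
      rw [show 2 * (K + 1) = 2 * K + 1 + 1 by ring, Finset.sum_range_succ, Finset.sum_range_succ,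
        Finset.sum_range_succ, ih, add_assoc]
  rcases Nat.even_or_odd' n with ⟨K, rfl | rfl⟩
  · simp [h2]
  · rw [Finset.sum_range_succ, h2, show (2 * K + 1) / 2 = K by omega,
      if_pos (show (2 * K + 1) % 2 = 1 by omega), show 2 * K + 1 - 1 = 2 * K by omega]

/-- A series converges if its terms tend to zero and the sums of consecutive pairs of terms form a
convergent series. -/
theorem hasSum_conditional_of_pairs {X : Type*} [NormedAddCommGroup X] {t : ℕ → X} {x : X}
    (h0 : Tendsto t atTop (𝓝 0)) (h : HasSum (fun k ↦ t (2 * k) + t (2 * k + 1)) x) :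
    HasSum t x (SummationFilter.conditional ℕ) := by
  rw [hasSum_conditional_iff]
  simp only [sum_range_eq_pairs t]
  rw [← add_zero x]
  have hdiv : Tendsto (fun n : ℕ ↦ n / 2) atTop atTop :=
    Filter.tendsto_atTop_atTop.2 fun b ↦ ⟨2 * b, fun a ha ↦ by omega⟩
  refine (h.tendsto_sum_nat.comp hdiv).add ?_
  have h1 : Tendsto (fun n ↦ ‖t (n - 1)‖) atTop (𝓝 0) := by
    simpa using (h0.comp (tendsto_sub_atTop_nat 1)).norm
  refine squeeze_zero_norm (fun n ↦ ?_) h1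
  split_ifs <;> simp

variable {X : Type*} [NormedAddCommGroup X] [NormedSpace ℂ X] {e : SchauderBasis ℂ X}

theorem coord_of_hasSum_subseq (e : SchauderBasis ℂ X) {i : ℕ → ℕ} (hi : Function.Injective i)
    {a : ℕ → ℂ} {y : X} (hy : HasSum (fun k ↦ a k • e (i k)) y) (k : ℕ) :
    e.coord (i k) y = a k := by
  have h2 := hasSum_single (f := fun l ↦ e.coord (i k) (a l • e (i l))) k fun l hl ↦ by
    simp [coord_ne e (hi.ne hl.symm)]
  simpa [coord_self] using ((e.coord (i k)).hasSum hy).unique h2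

theorem coord_eq_zero_of_hasSum_subseq (e : SchauderBasis ℂ X) {i : ℕ → ℕ}
    {a : ℕ → ℂ} {y : X} (hy : HasSum (fun k ↦ a k • e (i k)) y) {n : ℕ} (hn : ∀ k, i k ≠ n) :
    e.coord n y = 0 := by
  have h := (e.coord n).hasSum hy
  simp only [map_smul, smul_eq_mul, coord_ne e (hn _).symm, mul_zero] at h
  exact h.unique hasSum_zero

theorem hasSum_splitting [CompleteSpace X] (he : IsOneUnconditional e) {u v : ℕ → ℕ}
    (huv : IsSplitting u v) (x : X) :
    HasSum (fun k ↦ e.coord (u k) x • e (u k) + e.coord (v k) x • e (v k)) x := by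
  obtain ⟨y, hy⟩ := (hasSum_expansion he x).summable.comp_injective huv.injective_left
  obtain ⟨z, hz⟩ := (hasSum_expansion he x).summable.comp_injective huv.injective_right
  simp only [Function.comp_def] at hy hz
  have hx : x = y + z := ext_coord e fun n ↦ by
    rcases huv.cover n with ⟨k, rfl⟩ | ⟨k, rfl⟩
    · rw [map_add, coord_of_hasSum_subseq e huv.injective_left hy,
        coord_eq_zero_of_hasSum_subseq e hz fun l ↦ (huv.ne k l).symm, add_zero]
    · rw [map_add, coord_of_hasSum_subseq e huv.injective_right hz,
        coord_eq_zero_of_hasSum_subseq e hy fun l ↦ huv.ne l k, zero_add]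
  convert hy.add hz using 1

theorem tendsto_coord [CompleteSpace X] (hn : IsNormalized e) (x : X) {i : ℕ → ℕ}
    (hi : Function.Injective i) : Tendsto (fun k ↦ e.coord (i k) x) atTop (𝓝 0) := by
  rw [tendsto_zero_iff_norm_tendsto_zero]
  have h := ((tendsto_coord_smul e x).comp hi.nat_tendsto_atTop).norm
  simpa [Function.comp_def, norm_smul, hn _] using h

/-- The perturbation of the basis `e` along a splitting: the pair `e (u k)`, `e (v k)` is replaced
by `e (u k)`, `e (u k) + e (v k)`. The parameter `b` is the parity of the position of the
unperturbed vector. -/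
noncomputable def perturbedBasis [CompleteSpace X] (he : IsOneUnconditional e) (hn : IsNormalized e)
    {u v : ℕ → ℕ} (huv : IsSplitting u v) (b : ℕ) (hb : b ≤ 1) : SchauderBasis ℂ X where
  basis m := if m % 2 = b then e (u (m / 2)) else e (u (m / 2)) + e (v (m / 2))
  coord m := if m % 2 = b then e.coord (u (m / 2)) - e.coord (v (m / 2)) else e.coord (v (m / 2))
  ortho i j := by
    have huv' : ∀ k l, e.coord (u k) (e (v l)) = 0 := fun k l ↦ coord_ne e (huv.ne k l)
    have hvu : ∀ k l, e.coord (v k) (e (u l)) = 0 := fun k l ↦ coord_ne e (huv.ne l k).symm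
    have huu : ∀ k l, e.coord (u k) (e (u l)) = if k = l then 1 else 0 := fun k l ↦ by
      simp [e.ortho, Pi.single_apply, huv.injective_left.eq_iff]
    have hvv : ∀ k l, e.coord (v k) (e (v l)) = if k = l then 1 else 0 := fun k l ↦ by
      simp [e.ortho, Pi.single_apply, huv.injective_right.eq_iff]
    have hsingle : (Pi.single j (1 : ℂ) : ℕ → ℂ) i = if i = j then 1 else 0 := by
      simp [Pi.single_apply]
    have hij : i = j ↔ i / 2 = j / 2 ∧ i % 2 = j % 2 := by omega
    refine Eq.trans ?_ (hsingle.symm.trans (by congr))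
    by_cases h1 : i % 2 = b <;> by_cases h2 : j % 2 = b <;> by_cases h3 : i / 2 = j / 2 <;>
      simp [h1, h2, h3, huu, hvv, huv', hvu, hij] <;> omega
  expansion x := by
    refine hasSum_conditional_of_pairs ?_ ?_
    · have hu := (tendsto_coord hn x huv.injective_left).norm
      have hv := (tendsto_coord hn x huv.injective_right).norm
      have hdiv : Tendsto (fun n : ℕ ↦ n / 2) atTop atTop :=
        Filter.tendsto_atTop_atTop.2 fun b ↦ ⟨2 * b, fun a ha ↦ by omega⟩
      have h := ((hu.add hv).mul_const 2).comp hdiv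
      simp only [norm_zero, add_zero, zero_mul] at h
      refine squeeze_zero_norm (fun m ↦ ?_) h
      simp only [Function.comp_apply]
      have hadd := norm_add_le (e (u (m / 2))) (e (v (m / 2)))
      have hsub := norm_sub_le (e.coord (u (m / 2)) x) (e.coord (v (m / 2)) x)
      rw [hn, hn] at hadd
      have h0 := norm_nonneg (e.coord (u (m / 2)) x)
      have h0' := norm_nonneg (e.coord (v (m / 2)) x)
      split_ifs
      · rw [norm_smul, hn, _root_.sub_apply]
        linarith
      · rw [norm_smul]
        nlinarith
    · convert hasSum_splitting he huv x using 2 with k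
      have h1 : (2 * k + 1) / 2 = k := by omega
      interval_cases b <;> simp [h1, sub_smul] <;> abel

section

variable [CompleteSpace X] (he : IsOneUnconditional e) (hn : IsNormalized e) {u v : ℕ → ℕ}
  (huv : IsSplitting u v) (b : ℕ) (hb : b ≤ 1)

theorem perturbedBasis_left (k : ℕ) : perturbedBasis he hn huv b hb (2 * k + b) = e (u k) := by
  have h1 : (2 * k + b) % 2 = b := by omega
  have h2 : (2 * k + b) / 2 = k := by omega
  simp [perturbedBasis, h1, h2]

theorem perturbedBasis_right (k : ℕ) :
    perturbedBasis he hn huv b hb (2 * k + (1 - b)) = e (u k) + e (v k) := by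
  have h1 : (2 * k + (1 - b)) % 2 ≠ b := by omega
  have h2 : (2 * k + (1 - b)) / 2 = k := by omega
  simp only [perturbedBasis, if_neg h1, h2]

theorem coord_perturbedBasis_left (k : ℕ) (x : X) :
    (perturbedBasis he hn huv b hb).coord (2 * k + b) x = e.coord (u k) x - e.coord (v k) x := by
  have h1 : (2 * k + b) % 2 = b := by omega
  have h2 : (2 * k + b) / 2 = k := by omega
  simp [perturbedBasis, h1, h2]

theorem coord_perturbedBasis_right (k : ℕ) (x : X) :
    (perturbedBasis he hn huv b hb).coord (2 * k + (1 - b)) x = e.coord (v k) x := by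
  have h1 : (2 * k + (1 - b)) % 2 ≠ b := by omega
  have h2 : (2 * k + (1 - b)) / 2 = k := by omega
  simp only [perturbedBasis, if_neg h1, h2]

end

/-- The sequence `c` is bounded by `B`, and its differences over consecutive pairs sum up to at most
`S`. -/
structure IsPairBounded (c : ℕ → ℂ) (B S : ℝ) : Prop where
  norm_le : ∀ m, ‖c m‖ ≤ B
  sum_le : ∀ n, ∑ k ∈ Finset.range n, ‖c (2 * k) - c (2 * k + 1)‖ ≤ S

/-- Pair-bounded sequences act as multipliers with respect to `f`, with a norm controlled by the
bounds. -/
def HasPairMultipliers (f : SchauderBasis ℂ X) : Prop :=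
  ∀ (c : ℕ → ℂ) (B S : ℝ), IsPairBounded c B S →
    ∃ M : X →L[ℂ] X, (∀ m x, f.coord m (M x) = c m * f.coord m x) ∧ ‖M‖ ≤ 2 * B + S

/-- With respect to `e`, a multiplier of the perturbed basis is the sum of a diagonal operator,
which is controlled by unconditionality, and of an absolutely convergent series of rank one
operators. -/
theorem hasPairMultipliers_perturbedBasis [CompleteSpace X] (he : IsOneUnconditional e)
    (hn : IsNormalized e) {u v : ℕ → ℕ} (huv : IsSplitting u v) (b : ℕ) (hb : b ≤ 1) :
    HasPairMultipliers (perturbedBasis he hn huv b hb) := by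
  rintro c B S ⟨hB, hS⟩
  have hB0 : 0 ≤ B := (norm_nonneg _).trans (hB 0)
  let w : ℕ → ℂ := Function.extend u (fun k ↦ c (2 * k + b))
    (Function.extend v (fun k ↦ c (2 * k + (1 - b))) 0)
  have hwu : ∀ k, w (u k) = c (2 * k + b) := fun k ↦ huv.injective_left.extend_apply _ _ _
  have hwv : ∀ k, w (v k) = c (2 * k + (1 - b)) := fun k ↦ by
    simp only [w]
    rw [Function.extend_apply' _ _ _ (by rintro ⟨l, hl⟩; exact huv.ne _ _ hl),
      huv.injective_right.extend_apply]
  obtain ⟨D, hD, hDB⟩ := exists_diagonal he w (B := B) fun n ↦ by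
    rcases huv.cover n with ⟨k, rfl⟩ | ⟨k, rfl⟩
    · rw [hwu]; exact hB _
    · rw [hwv]; exact hB _
  let d : ℕ → ℂ := fun k ↦ c (2 * k + (1 - b)) - c (2 * k + b)
  have hd : ∀ k, ‖d k‖ = ‖c (2 * k) - c (2 * k + 1)‖ := fun k ↦ by
    simp only [d]
    interval_cases b
    · rw [norm_sub_rev]; rfl
    · rfl
  let N : ℕ → X →L[ℂ] X := fun k ↦ d k • (e.coord (v k)).smulRight (e (u k))
  have hN : ∀ k, ‖N k‖ ≤ ‖c (2 * k) - c (2 * k + 1)‖ := fun k ↦ by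
    rw [← hd]
    simp only [N, norm_smul, ContinuousLinearMap.norm_smulRight_apply, hn (u k), mul_one]
    refine mul_le_of_le_one_right (norm_nonneg _) ?_
    exact ContinuousLinearMap.opNorm_le_bound _ zero_le_one fun x ↦ by
      simpa using norm_coord_le he hn (v k) x
  have hs : Summable fun k ↦ ‖c (2 * k) - c (2 * k + 1)‖ :=
    summable_of_sum_range_le (fun _ ↦ norm_nonneg _) hS
  have hsN : Summable N := Summable.of_norm_bounded hs hN
  have hsN' : Summable fun k ↦ ‖N k‖ := Summable.of_nonneg_of_le (fun _ ↦ norm_nonneg _) hN hs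
  have hNx : ∀ x, HasSum (fun k ↦ (d k * e.coord (v k) x) • e (u k)) ((∑' k, N k) x) := fun x ↦ by
    have := hsN.hasSum.mapL (ContinuousLinearMap.apply ℂ X x)
    convert this using 1
    · ext k
      simp [N, mul_smul]
    · rfl
  refine ⟨D + ∑' k, N k, fun m x ↦ ?_, (norm_add_le _ _).trans (add_le_add hDB ?_)⟩
  · have h1 : ∀ k, e.coord (u k) ((D + ∑' k, N k) x) =
        c (2 * k + b) * e.coord (u k) x + d k * e.coord (v k) x := fun k ↦ by
      rw [_root_.add_apply, map_add, hD, hwu,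
        coord_of_hasSum_subseq e huv.injective_left (hNx x)]
    have h2 : ∀ k, e.coord (v k) ((D + ∑' k, N k) x) =
        c (2 * k + (1 - b)) * e.coord (v k) x := fun k ↦ by
      rw [_root_.add_apply, map_add, hD, hwv,
        coord_eq_zero_of_hasSum_subseq e (hNx x) (fun l ↦ huv.ne _ _), add_zero]
    by_cases h : m % 2 = b
    · have hm : m = 2 * (m / 2) + b := by omega
      rw [hm, coord_perturbedBasis_left, coord_perturbedBasis_left, h1, h2]
      simp only [d]
      ring
    · have hm : m = 2 * (m / 2) + (1 - b) := by omega
      rw [hm, coord_perturbedBasis_right, coord_perturbedBasis_right, h2]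
  · refine (norm_tsum_le_tsum_norm hsN').trans ?_
    refine (hsN'.tsum_le_tsum hN hs).trans ?_
    exact Real.tsum_le_of_sum_range_le (fun _ ↦ norm_nonneg _) hS

end Perturbation

/-! ### Lacunary exponents and elementary estimates -/

section Estimates

/-- The exponents of the multiplier: in the `k`-th pair, the position of parity `b` carries
`2 * 4 ^ k` and the other one `4 ^ k`. -/
noncomputable def rate (b m : ℕ) : ℝ := if m % 2 = b then 2 * 4 ^ (m / 2) else 4 ^ (m / 2)

theorem rate_pos (b m : ℕ) : 0 < rate b m := by
  unfold rate; split_ifs <;> positivity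

theorem rate_left {b : ℕ} (hb : b ≤ 1) (k : ℕ) : rate b (2 * k + b) = 2 * 4 ^ k := by
  have h1 : (2 * k + b) % 2 = b := by omega
  have h2 : (2 * k + b) / 2 = k := by omega
  simp [rate, h1, h2]

theorem rate_right {b : ℕ} (hb : b ≤ 1) (k : ℕ) : rate b (2 * k + (1 - b)) = 4 ^ k := by
  have h1 : (2 * k + (1 - b)) % 2 ≠ b := by omega
  have h2 : (2 * k + (1 - b)) / 2 = k := by omega
  simp only [rate, if_neg h1, h2]

theorem two_pow_le_two_mul_rate (b m : ℕ) : (2 : ℝ) ^ m ≤ 2 * rate b m := by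
  have h : (2 : ℝ) ^ m ≤ 2 * 4 ^ (m / 2) := by
    calc (2 : ℝ) ^ m ≤ 2 ^ (1 + 2 * (m / 2)) := pow_le_pow_right₀ one_le_two (by omega)
      _ = 2 * 4 ^ (m / 2) := by rw [pow_add, pow_mul]; norm_num
  have h0 : (0 : ℝ) < 4 ^ (m / 2) := by positivity
  unfold rate
  split_ifs <;> linarith

/-- The function `s / (1 + s) ^ 2` is dominated by increments of the bounded function `s / (1 + s)`,
so its values along a geometric progression have bounded sums. -/
theorem sum_geometric_decay_le {t : ℝ} (ht : 0 < t) (n : ℕ) :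
    ∑ k ∈ Finset.range n, 4 ^ k * t / (1 + 4 ^ k * t) ^ 2 ≤ 4 / 3 := by
  have hstep : ∀ s : ℝ, 0 < s → s / (1 + s) ^ 2 ≤ 4 / 3 * (4 * s / (1 + 4 * s) - s / (1 + s)) := by
    intro s hs
    have : 4 * s / (1 + 4 * s) - s / (1 + s) = 3 * s / ((1 + 4 * s) * (1 + s)) := by
      field_simp; ring
    rw [this, mul_div_assoc', div_le_div_iff₀ (by positivity) (by positivity)]
    have : 0 ≤ s * (1 + s) := by positivity
    nlinarith [mul_nonneg this hs.le]
  have htel : ∀ n : ℕ, ∑ k ∈ Finset.range n, 4 ^ k * t / (1 + 4 ^ k * t) ^ 2 ≤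
      4 / 3 * (4 ^ n * t / (1 + 4 ^ n * t)) := by
    intro n
    induction n with
    | zero => simp; positivity
    | succ n ih =>
      rw [Finset.sum_range_succ]
      have := hstep (4 ^ n * t) (by positivity)
      rw [← mul_assoc 4, ← pow_succ' (4 : ℝ) n] at this
      linarith
  refine (htel n).trans ?_
  have : 4 ^ n * t / (1 + 4 ^ n * t) ≤ 1 := by
    rw [div_le_one (by positivity)]; linarith
  linarith

/-- As the exponents in each pair are `s` and `2 * s` with `s = 4 ^ k`, the symbol `g (rate b m)` is
pair-bounded if `g s - g (2 * s)` decays at zero and at infinity. -/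
theorem isPairBounded_of_decay {g : ℝ → ℂ} {B K t : ℝ} (ht : 0 < t) (hK : 0 ≤ K)
    (hB : ∀ s, 0 < s → ‖g s‖ ≤ B)
    (h : ∀ s, 0 < s → ‖g s - g (2 * s)‖ ≤ K * (s * t / (1 + s * t) ^ 2)) {b : ℕ} (hb : b ≤ 1) :
    IsPairBounded (fun m ↦ g (rate b m)) B (K * (4 / 3)) where
  norm_le m := hB _ (rate_pos b m)
  sum_le n := by
    refine le_trans ?_ (mul_le_mul_of_nonneg_left (sum_geometric_decay_le ht n) hK)
    rw [Finset.mul_sum]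
    refine Finset.sum_le_sum fun k _ ↦ ?_
    have h1 := rate_left hb k
    have h2 := rate_right hb k
    have := h (4 ^ k) (by positivity)
    interval_cases b
    · simp only [add_zero, Nat.sub_zero] at h1 h2
      rwa [h1, h2, norm_sub_rev]
    · simp only [Nat.sub_self, add_zero] at h1 h2
      rwa [h1, h2]

theorem isPairBounded_single (m : ℕ) : IsPairBounded (Pi.single m 1) 1 1 where
  norm_le n := by
    by_cases h : n = m <;> simp [h]
  sum_le n := by
    have hle : ∀ k, ‖(Pi.single m 1 : ℕ → ℂ) (2 * k) - (Pi.single m 1 : ℕ → ℂ) (2 * k + 1)‖ ≤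
        if k = m / 2 then 1 else 0 := by
      intro k
      by_cases h1 : 2 * k = m
      · have h2 : 2 * k + 1 ≠ m := by omega
        subst h1
        simp
      · by_cases h2 : 2 * k + 1 = m
        · have h3 : k = m / 2 := by omega
          simp [h1, h2, ← h3]
        · have : (if k = m / 2 then (1 : ℝ) else 0) = 0 := if_neg (by omega)
          simp [h1, h2, this]
    refine (Finset.sum_le_sum fun k _ ↦ hle k).trans ?_
    rw [Finset.sum_ite_eq']
    split_ifs <;> simp

/-- On a sector of angle less than `π / 2`, where `κ * ‖z‖ ≤ re z`, the exponentials are pair-bounded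
uniformly in `z`. -/
theorem isPairBounded_exp {z : ℂ} {κ : ℝ} (hκ : 0 < κ) (hκ2 : κ ≤ 2) (hz : z ≠ 0)
    (h : κ * ‖z‖ ≤ z.re) {b : ℕ} (hb : b ≤ 1) :
    IsPairBounded (fun m ↦ Complex.exp (-(rate b m : ℂ) * z)) 1 ((2 / κ) ^ 2 * (4 / 3)) := by
  have hz0 : 0 < ‖z‖ := norm_pos_iff.2 hz
  have hre : 0 < z.re := lt_of_lt_of_le (by positivity) h
  have hnorm : ∀ s : ℝ, ‖Complex.exp (-(s : ℂ) * z)‖ = Real.exp (-(s * z.re)) := by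
    intro s
    rw [Complex.norm_exp]
    simp
  refine isPairBounded_of_decay (g := fun s ↦ Complex.exp (-(s : ℂ) * z)) hz0 (by positivity)
    (fun s hs ↦ ?_) (fun s hs ↦ ?_) hb
  · rw [hnorm, Real.exp_le_one_iff]
    have := mul_pos hs hre
    linarith
  · have hfac : Complex.exp (-(s : ℂ) * z) - Complex.exp (-((2 * s : ℝ) : ℂ) * z) =
        Complex.exp (-(s : ℂ) * z) * (1 - Complex.exp (-(s : ℂ) * z)) := by
      rw [mul_sub, ← Complex.exp_add, mul_one]
      congr 2
      push_cast
      ring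
    have hone : ‖1 - Complex.exp (-(s : ℂ) * z)‖ ≤ s * ‖z‖ := by
      have hlip := Convex.norm_image_sub_le_of_norm_hasDerivWithin_le
        (f := fun r : ℝ ↦ Complex.exp (-(r : ℂ) * z))
        (f' := fun r : ℝ ↦ Complex.exp (-(r : ℂ) * z) * (-z)) (s := Set.Ici 0) (C := ‖z‖)
        (x := s) (y := 0) (fun r _ ↦ by
          have h1 : HasDerivAt (fun r : ℝ ↦ -(r : ℂ) * z) (-z) r := by
            simpa using ((Complex.ofRealCLM.hasDerivAt (x := r)).neg.mul_const z)
          exact h1.cexp.hasDerivWithinAt) (fun r hr ↦ by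
          rw [norm_mul, norm_neg, hnorm]
          refine mul_le_of_le_one_left (norm_nonneg z) ?_
          rw [Real.exp_le_one_iff]
          have := mul_nonneg (Set.mem_Ici.1 hr) hre.le
          linarith) (convex_Ici 0) hs.le (Set.mem_Ici.2 le_rfl)
      simpa [abs_of_pos hs, mul_comm] using hlip
    rw [hfac, norm_mul, hnorm]
    have hx : 0 < s * ‖z‖ := by positivity
    have hexp : Real.exp (-(s * z.re)) * (1 + s * ‖z‖) ^ 2 ≤ (2 / κ) ^ 2 := by
      have h1 : κ / 2 * (1 + s * ‖z‖) ≤ Real.exp (s * z.re / 2) := by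
        have := Real.add_one_le_exp (s * z.re / 2)
        nlinarith [mul_le_mul_of_nonneg_left h hs.le]
      have h2 : (κ / 2 * (1 + s * ‖z‖)) ^ 2 ≤ Real.exp (s * z.re) := by
        calc _ ≤ Real.exp (s * z.re / 2) ^ 2 := by gcongr
          _ = Real.exp (s * z.re) := by rw [← Real.exp_nat_mul]; congr 1; push_cast; ring
      calc Real.exp (-(s * z.re)) * (1 + s * ‖z‖) ^ 2
          = Real.exp (-(s * z.re)) * ((κ / 2 * (1 + s * ‖z‖)) ^ 2 * (2 / κ) ^ 2) := by
            congr 1; field_simp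
        _ ≤ Real.exp (-(s * z.re)) * (Real.exp (s * z.re) * (2 / κ) ^ 2) := by gcongr
        _ = (2 / κ) ^ 2 := by rw [← mul_assoc, ← Real.exp_add]; simp
    calc Real.exp (-(s * z.re)) * ‖1 - Complex.exp (-(s : ℂ) * z)‖
        ≤ Real.exp (-(s * z.re)) * (s * ‖z‖) := by gcongr
      _ = Real.exp (-(s * z.re)) * (1 + s * ‖z‖) ^ 2 * (s * ‖z‖ / (1 + s * ‖z‖) ^ 2) := by
        field_simp
      _ ≤ (2 / κ) ^ 2 * (s * ‖z‖ / (1 + s * ‖z‖) ^ 2) := by gcongr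

/-- Outside a sector around the positive axis the symbols of `z R(z, A)` are pair-bounded uniformly in
`z`. -/
theorem isPairBounded_resolvent {z : ℂ} {δ : ℝ} (hδ : 0 < δ) (hz : z ≠ 0)
    (h : ∀ s : ℝ, 0 < s → δ * (‖z‖ + s) ≤ ‖z - s‖) {b : ℕ} (hb : b ≤ 1) :
    IsPairBounded (fun m ↦ z * (z - rate b m)⁻¹) δ⁻¹ ((δ⁻¹) ^ 2 * (4 / 3)) := by
  have hz0 : 0 < ‖z‖ := norm_pos_iff.2 hz
  have hne : ∀ s : ℝ, 0 < s → z - s ≠ 0 := fun s hs ↦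
    norm_pos_iff.1 (lt_of_lt_of_le (by positivity) (h s hs))
  refine isPairBounded_of_decay (g := fun s ↦ z * (z - (s : ℂ))⁻¹) (t := ‖z‖⁻¹) (by positivity)
    (by positivity) (fun s hs ↦ ?_) (fun s hs ↦ ?_) hb
  · have hp : 0 < ‖z - s‖ := norm_pos_iff.2 (hne s hs)
    rw [norm_mul, norm_inv, ← div_eq_mul_inv, div_le_iff₀ hp, inv_mul_eq_div, le_div_iff₀ hδ]
    have := h s hs
    nlinarith
  · have h1 := h s hs
    have h2 := h (2 * s) (by positivity)
    have hp1 : 0 < ‖z - s‖ := norm_pos_iff.2 (hne s hs)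
    have hp2 : 0 < ‖z - (2 * s : ℝ)‖ := norm_pos_iff.2 (hne (2 * s) (by positivity))
    have hid : z * (z - (s : ℂ))⁻¹ - z * (z - ((2 * s : ℝ) : ℂ))⁻¹ =
        -(z * s) / ((z - (s : ℂ)) * (z - ((2 * s : ℝ) : ℂ))) := by
      have := hne s hs
      have := hne (2 * s) (by positivity)
      field_simp
      push_cast
      ring
    rw [hid, norm_div, norm_neg, norm_mul, norm_mul, Complex.norm_real, Real.norm_of_nonneg hs.le,
      div_le_iff₀ (by positivity)]
    have h3 : (δ * (‖z‖ + s)) * (δ * (‖z‖ + s)) ≤ ‖z - s‖ * ‖z - (2 * s : ℝ)‖ := by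
      refine mul_le_mul h1 (le_trans ?_ h2) (by positivity) (by positivity)
      nlinarith
    calc ‖z‖ * s = δ⁻¹ ^ 2 * (s * ‖z‖⁻¹ / (1 + s * ‖z‖⁻¹) ^ 2) *
          ((δ * (‖z‖ + s)) * (δ * (‖z‖ + s))) := by field_simp
      _ ≤ _ := by gcongr

/-- The multiplier by which difference quotients of the semigroup differ from its generator. -/
theorem isPairBounded_quotient {t : ℝ} (ht : 0 < t) {b : ℕ} (hb : b ≤ 1) :
    IsPairBounded (fun m ↦ (((1 - Real.exp (-(rate b m * t))) / (rate b m * t) : ℝ) : ℂ)) 1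
      (2 * (4 / 3)) := by
  let ψ : ℝ → ℝ := fun x ↦ (1 - Real.exp (-x)) / x
  have hψ0 : ∀ x, 0 < x → 0 ≤ ψ x := fun x hx ↦ by
    refine div_nonneg ?_ hx.le
    have := Real.exp_le_one_iff.2 (neg_nonpos.2 hx.le)
    linarith
  have hψ1 : ∀ x, 0 < x → ψ x ≤ 1 := fun x hx ↦ by
    rw [div_le_one hx]
    have := Real.add_one_le_exp (-x)
    linarith
  have hψ2 : ∀ x, 0 < x → ψ x * x ≤ 1 := fun x hx ↦ by
    simp only [ψ]
    rw [div_mul_cancel₀ _ hx.ne']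
    have := Real.exp_pos (-x)
    linarith
  have hψ3 : ∀ x, 0 < x → ψ x - ψ (2 * x) = x * ψ x ^ 2 / 2 := fun x hx ↦ by
    have : Real.exp (-(2 * x)) = Real.exp (-x) ^ 2 := by
      rw [← Real.exp_nat_mul]; congr 1; push_cast; ring
    simp only [ψ]
    rw [this]
    field_simp
    ring
  refine isPairBounded_of_decay (g := fun s ↦ ((ψ (s * t) : ℝ) : ℂ)) ht (by norm_num)
    (fun s hs ↦ ?_) (fun s hs ↦ ?_) hb
  · rw [Complex.norm_real, Real.norm_of_nonneg (hψ0 _ (by positivity))]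
    exact hψ1 _ (by positivity)
  · have hx : 0 < s * t := by positivity
    have h3 := hψ3 _ hx
    have h0 := hψ0 _ hx
    rw [← Complex.ofReal_sub, mul_assoc, h3, Complex.norm_real,
      Real.norm_of_nonneg (by positivity), mul_div_assoc', div_le_div_iff₀ two_pos (by positivity)]
    have h4 : ψ (s * t) * (1 + s * t) ≤ 2 := by
      have := hψ1 _ hx
      have := hψ2 _ hx
      linarith
    have h5 : (ψ (s * t) * (1 + s * t)) ^ 2 ≤ 2 ^ 2 := by gcongr
    nlinarith

end Estimates

/-! ### Sectors -/

section Sectors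

theorem norm_mul_cos_arg (z : ℂ) : ‖z‖ * Real.cos |z.arg| = z.re := by
  rw [Real.cos_abs, Complex.norm_mul_cos_arg]

theorem norm_mul_cos_le_of_mem_closure {ω : ℝ} (hω : ω ≤ Real.pi) {z : ℂ}
    (hz : z ∈ closure (sector ω)) : ‖z‖ * Real.cos ω ≤ z.re := by
  have hcl : IsClosed {z : ℂ | ‖z‖ * Real.cos ω ≤ z.re} :=
    isClosed_le (by fun_prop) Complex.continuous_re
  refine closure_minimal (fun w hw ↦ ?_) hcl hz
  rw [Set.mem_ofPred_eq, ← norm_mul_cos_arg w]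
  exact mul_le_mul_of_nonneg_left
    (Real.cos_le_cos_of_nonneg_of_le_pi (abs_nonneg _) hω hw.2.le) (norm_nonneg _)

theorem zero_mem_closure_sector {ω : ℝ} (hω : 0 < ω) : (0 : ℂ) ∈ closure (sector ω) := by
  have h : Tendsto (fun n : ℕ ↦ ((1 / ((n : ℝ) + 1) : ℝ) : ℂ)) atTop (𝓝 0) := by
    have := (Complex.continuous_ofReal.tendsto 0).comp
      (tendsto_one_div_add_atTop_nhds_zero_nat (𝕜 := ℝ))
    simpa only [Function.comp_def, Complex.ofReal_zero] using this
  refine mem_closure_of_tendsto h (Eventually.of_forall fun n ↦ ?_)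
  have hp : (0 : ℝ) < 1 / ((n : ℝ) + 1) := by positivity
  exact ⟨by exact_mod_cast hp.ne', by rw [Complex.arg_ofReal_of_nonneg hp.le]; simpa using hω⟩

/-- Outside a sector, the distance to a positive number `s` is comparable to `‖z‖ + s`. -/
theorem exists_le_norm_sub_of_notMem {ω : ℝ} (hω : 0 < ω) :
    ∃ δ : ℝ, 0 < δ ∧ ∀ z ∉ closure (sector ω), z ≠ 0 ∧
      ∀ s : ℝ, 0 < s → δ * (‖z‖ + s) ≤ ‖z - s‖ := by
  -- For `ω > π` the complement of the closed sector is empty.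
  by_cases hπ : ω ≤ Real.pi
  · have hcos : Real.cos ω < 1 := by
      rw [← Real.cos_zero]
      exact Real.cos_lt_cos_of_nonneg_of_le_pi le_rfl hπ hω
    have hcos' := Real.neg_one_le_cos ω
    refine ⟨Real.sqrt ((1 - Real.cos ω) / 2), Real.sqrt_pos.2 (by linarith), fun z hz ↦ ?_⟩
    have hz0 : z ≠ 0 := by rintro rfl; exact hz (zero_mem_closure_sector hω)
    refine ⟨hz0, fun s hs ↦ ?_⟩
    have harg : ω ≤ |z.arg| := by
      by_contra! h
      exact hz (subset_closure ⟨hz0, h⟩)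
    have hre : z.re ≤ ‖z‖ * Real.cos ω := by
      rw [← norm_mul_cos_arg z]
      exact mul_le_mul_of_nonneg_left
        (Real.cos_le_cos_of_nonneg_of_le_pi hω.le (Complex.abs_arg_le_pi z) harg) (norm_nonneg _)
    have hsq : ‖z - s‖ ^ 2 = ‖z‖ ^ 2 + s ^ 2 - 2 * s * z.re := by
      rw [Complex.sq_norm, Complex.sq_norm, Complex.normSq_apply, Complex.normSq_apply]
      simp
      ring
    refine (pow_le_pow_iff_left₀ (mul_nonneg (Real.sqrt_nonneg _) (by positivity)) (norm_nonneg _)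
      two_ne_zero).1 ?_
    rw [mul_pow, Real.sq_sqrt (by linarith), hsq]
    nlinarith [mul_le_mul_of_nonneg_left hre hs.le, sq_nonneg (‖z‖ - s), norm_nonneg z]
  · refine ⟨1, one_pos, fun z hz ↦ (hz ?_).elim⟩
    by_cases h0 : z = 0
    · rw [h0]; exact zero_mem_closure_sector hω
    · exact subset_closure ⟨h0, (Complex.abs_arg_le_pi z).trans_lt (not_le.1 hπ)⟩

theorem neg_notMem_closure_sector {ω : ℝ} (hω : ω < Real.pi) (hω0 : 0 < ω) {s : ℝ} (hs : 0 < s) :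
    (-(s : ℂ)) ∉ closure (sector ω) := by
  intro h
  have := norm_mul_cos_le_of_mem_closure hω.le h
  simp only [norm_neg, Complex.norm_real, Real.norm_of_nonneg hs.le, Complex.neg_re,
    Complex.ofReal_re] at this
  have hcos : -1 < Real.cos ω := by
    rw [← Real.cos_pi]
    exact Real.cos_lt_cos_of_nonneg_of_le_pi hω0.le le_rfl hω
  nlinarith

end Sectors

/-! ### Multipliers of a Schauder basis -/

section Multipliers

variable {X : Type*} [NormedAddCommGroup X] [NormedSpace ℂ X] {f : SchauderBasis ℂ X}

open Classical in
/-- The bounded multiplier of the sequence `c` with respect to the basis `f`, with the value zero if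
there is none. -/
noncomputable def mult (f : SchauderBasis ℂ X) (c : ℕ → ℂ) : X →L[ℂ] X :=
  if h : ∃ M : X →L[ℂ] X, ∀ m x, f.coord m (M x) = c m * f.coord m x then h.choose else 0

theorem mult_eq {c : ℕ → ℂ} {M : X →L[ℂ] X} (hM : ∀ m x, f.coord m (M x) = c m * f.coord m x) :
    mult f c = M := by
  have h : ∃ M : X →L[ℂ] X, ∀ m x, f.coord m (M x) = c m * f.coord m x := ⟨M, hM⟩
  ext x
  refine ext_coord f fun m ↦ ?_
  rw [mult, dif_pos h, h.choose_spec, hM]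

theorem coord_mult (hf : HasPairMultipliers f) {c : ℕ → ℂ} {B S : ℝ} (hc : IsPairBounded c B S)
    (m : ℕ) (x : X) : f.coord m (mult f c x) = c m * f.coord m x := by
  obtain ⟨M, hM, _⟩ := hf c B S hc
  rw [mult_eq hM, hM]

theorem norm_mult_le (hf : HasPairMultipliers f) {c : ℕ → ℂ} {B S : ℝ} (hc : IsPairBounded c B S) :
    ‖mult f c‖ ≤ 2 * B + S := by
  obtain ⟨M, hM, h⟩ := hf c B S hc
  rwa [mult_eq hM]

theorem mult_basis (hf : HasPairMultipliers f) {c : ℕ → ℂ} {B S : ℝ} (hc : IsPairBounded c B S)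
    (m : ℕ) : mult f c (f m) = c m • f m :=
  ext_coord f fun n ↦ by
    rw [coord_mult hf hc, map_smul, smul_eq_mul]
    by_cases h : n = m
    · rw [h]
    · rw [coord_ne f h, mul_zero, mul_zero]

/-- Uniformly bounded multipliers converge strongly to the identity if their symbols converge
pointwise to one. -/
theorem tendsto_mult (hf : HasPairMultipliers f) {ι : Type*} {l : Filter ι} {c : ι → ℕ → ℂ}
    {B S : ℝ} (hc : ∀ᶠ i in l, IsPairBounded (c i) B S)
    (hlim : ∀ m, Tendsto (fun i ↦ c i m) l (𝓝 1)) (x : X) :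
    Tendsto (fun i ↦ mult f (c i) x) l (𝓝 x) := by
  have hbasis : ∀ m, Tendsto (fun i ↦ mult f (c i) (f m)) l (𝓝 (f m)) := by
    intro m
    have h : Tendsto (fun i ↦ c i m • f m) l (𝓝 ((1 : ℂ) • f m)) := (hlim m).smul_const _
    rw [one_smul] at h
    refine h.congr' ?_
    filter_upwards [hc] with i hi
    rw [mult_basis hf hi]
  rw [Metric.tendsto_nhds]
  intro ε hε
  have hK : 0 < |2 * B + S| + 1 := by positivity
  have hx := hasSum_conditional_iff.1 (f.expansion x)
  obtain ⟨N, hN⟩ := (Metric.tendsto_atTop.1 hx (ε / (2 * (|2 * B + S| + 1))) (by positivity))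
  set y := ∑ m ∈ Finset.range N, f.coord m x • f m with hy
  have hxy : ‖y - x‖ < ε / (2 * (|2 * B + S| + 1)) := by
    rw [← dist_eq_norm]; exact hN N le_rfl
  have hylim : Tendsto (fun i ↦ mult f (c i) y) l (𝓝 y) := by
    simp only [hy, map_sum, map_smul]
    exact tendsto_finsetSum _ fun m _ ↦ (hbasis m).const_smul _
  filter_upwards [hc, Metric.tendsto_nhds.1 hylim (ε / 2) (by positivity)] with i hi h2
  rw [dist_eq_norm] at h2 ⊢
  have hsplit : mult f (c i) x - x = -(mult f (c i) (y - x)) + (mult f (c i) y - y) + (y - x) := by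
    rw [map_sub]; abel
  have h1 : ‖mult f (c i) (y - x)‖ ≤ |2 * B + S| * ‖y - x‖ :=
    (ContinuousLinearMap.le_opNorm _ _).trans
      (mul_le_mul_of_nonneg_right ((norm_mult_le hf hi).trans (le_abs_self _)) (norm_nonneg _))
  rw [hsplit]
  refine (norm_add₃_le).trans_lt ?_
  rw [norm_neg]
  rw [lt_div_iff₀ (by positivity)] at hxy
  nlinarith

/-- The unbounded multiplier of the real sequence `γ`, with its maximal domain. -/
noncomputable def multOp (f : SchauderBasis ℂ X) (γ : ℕ → ℝ) : X →ₗ.[ℂ] X :=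
  Submodule.toLinearPMap
    { carrier := {p : X × X | ∀ m, f.coord m p.2 = (γ m : ℂ) * f.coord m p.1}
      add_mem' := fun {p q} hp hq m ↦ by
        simp only [Prod.snd_add, Prod.fst_add, map_add, mul_add]
        rw [hp m, hq m]
      zero_mem' := fun m ↦ by simp
      smul_mem' := fun c p hp m ↦ by
        simp only [Prod.smul_snd, Prod.smul_fst, map_smul, smul_eq_mul]
        rw [hp m]
        ring }

theorem mem_graph_multOp {γ : ℕ → ℝ} {x y : X} :
    (x, y) ∈ (multOp f γ).graph ↔ ∀ m, f.coord m y = (γ m : ℂ) * f.coord m x := by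
  rw [multOp, Submodule.toLinearPMap_graph_eq]
  · rfl
  · rintro ⟨x, y⟩ h (rfl : x = 0)
    exact ext_coord f fun m ↦ by simpa using h m

theorem mem_domain_multOp {γ : ℕ → ℝ} {x y : X}
    (h : ∀ m, f.coord m y = (γ m : ℂ) * f.coord m x) :
    ∃ hx : x ∈ (multOp f γ).domain, multOp f γ ⟨x, hx⟩ = y := by
  obtain ⟨z, hz, hzy⟩ := (LinearPMap.mem_graph_iff _).1 (mem_graph_multOp.2 h)
  simp only at hz hzy
  subst hz
  exact ⟨z.2, hzy⟩

theorem coord_multOp_apply {γ : ℕ → ℝ} (x : (multOp f γ).domain) (m : ℕ) :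
    f.coord m (multOp f γ x) = (γ m : ℂ) * f.coord m (x : X) :=
  mem_graph_multOp.1 (LinearPMap.mem_graph _ x) m

theorem isSchauderMultiplier_multOp (γ : ℕ → ℝ) : IsSchauderMultiplier f γ (multOp f γ) := by
  intro x y
  rw [mem_graph_multOp]
  constructor
  · intro h
    have := f.expansion y
    simpa only [h] using this
  · exact fun h m ↦ coord_of_hasSum f h m

theorem dense_domain_multOp (γ : ℕ → ℝ) : Dense ((multOp f γ).domain : Set X) := by
  intro x
  refine mem_closure_of_tendsto (hasSum_conditional_iff.1 (f.expansion x))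
    (Eventually.of_forall fun n ↦ Submodule.sum_mem _ fun m _ ↦ Submodule.smul_mem _ _ ?_)
  refine (mem_domain_multOp (y := (γ m : ℂ) • f m) fun n ↦ ?_).1
  rw [map_smul, smul_eq_mul]
  by_cases h : n = m
  · rw [h]
  · rw [coord_ne f h, mul_zero, mul_zero]

end Multipliers

/-! ### Resolvents -/

section Resolvents

variable {X : Type*} [NormedAddCommGroup X] [NormedSpace ℂ X] {f : SchauderBasis ℂ X}

theorem IsResolventAt.unique {A : X →ₗ.[ℂ] X} {z : ℂ} {R R' : X →L[ℂ] X}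
    (h : IsResolventAt A z R) (h' : IsResolventAt A z R') : R = R' := by
  ext y
  obtain ⟨hy, hy'⟩ := h.1 y
  have := h'.2 ⟨R y, hy⟩
  rw [hy'] at this
  exact this.symm

theorem isResolventAt_multOp {γ : ℕ → ℝ} {z : ℂ} (hz : ∀ m, z ≠ γ m) {R : X →L[ℂ] X}
    (hR : ∀ m x, f.coord m (R x) = (z - γ m)⁻¹ * f.coord m x) :
    IsResolventAt (multOp f γ) z R := by
  have hz' : ∀ m, z - γ m ≠ 0 := fun m ↦ sub_ne_zero.2 (hz m)
  refine ⟨fun y ↦ ?_, fun x ↦ ext_coord f fun m ↦ ?_⟩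
  · obtain ⟨h, h'⟩ := mem_domain_multOp (f := f) (γ := γ) (x := R y) (y := z • R y - y) fun m ↦ by
      rw [map_sub, map_smul, hR, smul_eq_mul]
      have := hz' m
      field_simp
      ring
    exact ⟨h, by rw [h']; abel⟩
  · rw [hR, map_sub, map_smul, coord_multOp_apply, smul_eq_mul, ← sub_mul,
      inv_mul_cancel_left₀ (hz' m)]

variable {b : ℕ} (hb : b ≤ 1) (hf : HasPairMultipliers f)

include hb hf in
/-- Outside each sector around the positive axis the multiplier has a resolvent, and the operators
`z R(z, A)` are uniformly bounded there. -/
theorem exists_resolvent_bound {ω : ℝ} (hω : 0 < ω) :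
    ∃ C : ℝ, ∀ z ∉ closure (sector ω),
      ∃ R, IsResolventAt (multOp f (rate b)) z R ∧ ‖z • R‖ ≤ C := by
  obtain ⟨δ, hδ, h⟩ := exists_le_norm_sub_of_notMem hω
  refine ⟨2 * δ⁻¹ + δ⁻¹ ^ 2 * (4 / 3), fun z hz ↦ ?_⟩
  obtain ⟨hz0, hs⟩ := h z hz
  have hc := isPairBounded_resolvent hδ hz0 hs hb
  refine ⟨z⁻¹ • mult f (fun m ↦ z * (z - rate b m)⁻¹), isResolventAt_multOp (fun m hm ↦ ?_)
    (fun m x ↦ ?_), ?_⟩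
  · have h1 := hs _ (rate_pos b m)
    rw [hm, sub_self, norm_zero] at h1
    have h2 := rate_pos b m
    have : 0 < δ * (‖((rate b m : ℝ) : ℂ)‖ + rate b m) := by positivity
    linarith
  · rw [_root_.smul_apply, map_smul, coord_mult hf hc, smul_eq_mul]
    field_simp
  · rw [smul_smul, mul_inv_cancel₀ hz0, one_smul]
    exact norm_mult_le hf hc

include hb hf in
theorem sectorialCondition_multOp {ω : ℝ} (hω : 0 < ω) :
    SectorialCondition (multOp f (rate b)) ω := by
  refine ⟨fun z hz ↦ ?_, fun ε hε ↦ ?_⟩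
  · by_contra hcon
    obtain ⟨C, hC⟩ := exists_resolvent_bound hb hf hω
    obtain ⟨R, hR, _⟩ := hC z hcon
    exact hz ⟨R, hR⟩
  · obtain ⟨C, hC⟩ := exists_resolvent_bound hb hf (add_pos hω hε)
    refine ⟨C, fun z hz R hR ↦ ?_⟩
    obtain ⟨R', hR', h⟩ := hC z hz
    rwa [hR.unique hR']

include hb hf in
theorem isSectorial_multOp : IsSectorial (multOp f (rate b)) :=
  ⟨dense_domain_multOp _, Real.pi / 2, ⟨by positivity, by linarith [Real.pi_pos]⟩,
    sectorialCondition_multOp hb hf (by positivity)⟩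

include hb hf in
theorem sectorialAngle_multOp : sectorialAngle (multOp f (rate b)) = 0 := by
  have : {ω | ω ∈ Set.Ioo 0 Real.pi ∧ SectorialCondition (multOp f (rate b)) ω} =
      Set.Ioo 0 Real.pi := by
    ext ω
    exact ⟨fun h ↦ h.1, fun h ↦ ⟨h, sectorialCondition_multOp hb hf h.1⟩⟩
  rw [sectorialAngle, this, csInf_Ioo Real.pi_pos]

end Resolvents

/-! ### The semigroup -/

section Semigroup

variable {X : Type*} [NormedAddCommGroup X] [NormedSpace ℂ X] {f : SchauderBasis ℂ X} {b : ℕ}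

/-- The operators `exp (-z A)` for the multiplier `A` with exponents `rate b`. -/
noncomputable def expMult (f : SchauderBasis ℂ X) (b : ℕ) (z : ℂ) : X →L[ℂ] X :=
  mult f fun m ↦ Complex.exp (-(rate b m : ℂ) * z)

theorem expMult_zero : expMult f b 0 = ContinuousLinearMap.id ℂ X :=
  mult_eq fun m x ↦ by simp

theorem exists_isPairBounded_exp (hb : b ≤ 1) {z : ℂ} (hz : 0 < z.re) :
    ∃ B S, IsPairBounded (fun m ↦ Complex.exp (-(rate b m : ℂ) * z)) B S := by
  have hz0 : z ≠ 0 := by rintro rfl; simp at hz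
  have hp : 0 < ‖z‖ := norm_pos_iff.2 hz0
  have hle : z.re / ‖z‖ ≤ 1 := by
    rw [div_le_one hp]; exact Complex.re_le_norm z
  exact ⟨_, _, isPairBounded_exp (κ := z.re / ‖z‖) (by positivity) (by linarith) hz0
    (by rw [div_mul_cancel₀ _ hp.ne']) hb⟩

theorem isPairBounded_exp_real (hb : b ≤ 1) {t : ℝ} (ht : 0 ≤ t) :
    IsPairBounded (fun m ↦ Complex.exp (-(rate b m : ℂ) * t)) 1 (2 ^ 2 * (4 / 3)) := by
  rcases ht.eq_or_lt with rfl | ht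
  · exact ⟨fun m ↦ by simp, fun n ↦ by simp; norm_num⟩
  · have := isPairBounded_exp (z := t) (κ := 1) one_pos one_le_two (by exact_mod_cast ht.ne')
      (by simp [abs_of_pos ht]) hb
    simpa using this

variable (hb : b ≤ 1) (hf : HasPairMultipliers f)

include hb hf in
theorem coord_expMult {z : ℂ} (hz : 0 < z.re) (m : ℕ) (x : X) :
    f.coord m (expMult f b z x) = Complex.exp (-(rate b m : ℂ) * z) * f.coord m x := by
  obtain ⟨B, S, h⟩ := exists_isPairBounded_exp hb hz
  exact coord_mult hf h m x

include hb hf in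
theorem coord_expMult_real {t : ℝ} (ht : 0 ≤ t) (m : ℕ) (x : X) :
    f.coord m (expMult f b t x) = Complex.exp (-(rate b m : ℂ) * t) * f.coord m x :=
  coord_mult hf (isPairBounded_exp_real hb ht) m x

theorem tendsto_exp_mul_one (c : ℂ) {s : Set ℂ} :
    Tendsto (fun z : ℂ ↦ Complex.exp (c * z)) (𝓝[s] 0) (𝓝 1) := by
  have h : Continuous fun z : ℂ ↦ Complex.exp (c * z) := by fun_prop
  have := (h.tendsto 0).mono_left (nhdsWithin_le_nhds (s := s))
  simpa using this

include hb hf in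
theorem isC0Semigroup_expMult : IsC0Semigroup fun t : ℝ ↦ expMult f b t where
  map_zero := by simpa using expMult_zero
  map_add s t hs ht := by
    ext x
    refine ext_coord f fun m ↦ ?_
    rw [ContinuousLinearMap.comp_apply, coord_expMult_real hb hf (add_nonneg hs ht),
      coord_expMult_real hb hf hs, coord_expMult_real hb hf ht, ← mul_assoc, ← Complex.exp_add]
    congr 2
    push_cast
    ring
  tendsto_zero x := by
    refine tendsto_mult hf (B := 1) (S := 2 ^ 2 * (4 / 3)) ?_ (fun m ↦ ?_) x
    · filter_upwards [self_mem_nhdsWithin] with t ht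
      exact isPairBounded_exp_real hb (Set.mem_Ioi.1 ht).le
    · have h : Continuous fun t : ℝ ↦ Complex.exp (-(rate b m : ℂ) * t) := by fun_prop
      have := (h.tendsto 0).mono_left (nhdsWithin_le_nhds (s := Set.Ioi 0))
      simpa using this

theorem re_pos_of_mem_sector {z : ℂ} (hz : z ∈ sector (Real.pi / 2)) : 0 < z.re := by
  rw [← norm_mul_cos_arg]
  refine mul_pos (norm_pos_iff.2 hz.1) (Real.cos_pos_of_mem_Ioo ⟨?_, hz.2⟩)
  linarith [abs_nonneg z.arg, Real.pi_pos]

include hb hf in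
/-- On a right half-plane the exponentials decay so fast that `exp (-z A)` is an absolutely
convergent series of multiples of coordinate projections. -/
theorem differentiableOn_expMult [CompleteSpace X] :
    DifferentiableOn ℂ (expMult f b) {z | 0 < z.re} := by
  intro z₀ hz₀
  have hz₀' : 0 < z₀.re := hz₀
  set δ := z₀.re / 2 with hδ
  have hδ0 : 0 < δ := by positivity
  have hU : IsOpen {z : ℂ | δ < z.re} := isOpen_lt continuous_const Complex.continuous_re
  let F : ℕ → ℂ → X →L[ℂ] X := fun m z ↦
    Complex.exp (-(rate b m : ℂ) * z) • mult f (Pi.single m 1)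
  -- The coordinate projections have norm at most `3`, and `2 ^ m ≤ 2 * rate b m`.
  have hbound : ∀ m z, z ∈ {z : ℂ | δ < z.re} → ‖F m z‖ ≤ 6 / δ * (1 / 2) ^ m := by
    intro m z hz
    have hz' : δ < z.re := hz
    have hr := rate_pos b m
    have h2 := two_pow_le_two_mul_rate b m
    have h1 : ‖Complex.exp (-(rate b m : ℂ) * z)‖ ≤ 2 / δ * (1 / 2) ^ m := by
      rw [Complex.norm_exp]
      have hre : (-(rate b m : ℂ) * z).re = -(rate b m * z.re) := by simp
      rw [hre, Real.exp_neg]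
      have h3 : δ / 2 * 2 ^ m ≤ Real.exp (rate b m * z.re) := by
        have := Real.add_one_le_exp (rate b m * z.re)
        have := mul_le_mul_of_nonneg_left hz'.le hr.le
        nlinarith
      calc (Real.exp (rate b m * z.re))⁻¹ ≤ (δ / 2 * 2 ^ m)⁻¹ :=
            inv_anti₀ (by positivity) h3
        _ = 2 / δ * (1 / 2) ^ m := by
            rw [mul_inv, inv_div, one_div, inv_pow]
    have h3 := norm_mult_le hf (isPairBounded_single m)
    calc ‖F m z‖ = ‖Complex.exp (-(rate b m : ℂ) * z)‖ * ‖mult f (Pi.single m 1)‖ := by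
          simp only [F, norm_smul]
      _ ≤ 2 / δ * (1 / 2) ^ m * 3 := by
          refine mul_le_mul h1 (h3.trans (by norm_num)) (norm_nonneg _) (by positivity)
      _ = 6 / δ * (1 / 2) ^ m := by ring
  have hu : Summable fun m : ℕ ↦ 6 / δ * (1 / 2 : ℝ) ^ m :=
    (summable_geometric_of_lt_one (by norm_num) (by norm_num)).mul_left _
  have hd : DifferentiableOn ℂ (fun z ↦ ∑' m, F m z) {z : ℂ | δ < z.re} := by
    refine Complex.differentiableOn_tsum_of_summable_norm hu (fun m ↦ ?_) hU hbound
    exact fun z _ ↦ ((by fun_prop : DifferentiableAt ℂ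
      (fun z ↦ Complex.exp (-(rate b m : ℂ) * z)) z).smul_const _).differentiableWithinAt
  have heq : ∀ z ∈ {z : ℂ | δ < z.re}, expMult f b z = ∑' m, F m z := by
    intro z hz
    have hz' : δ < z.re := hz
    ext x
    refine ext_coord f fun n ↦ ?_
    have hs : Summable fun m ↦ F m z := Summable.of_norm_bounded hu fun m ↦ hbound m z hz
    have h1 : HasSum (fun m ↦ f.coord n (F m z x)) (f.coord n ((∑' m, F m z) x)) :=
      (f.coord n).hasSum (hs.hasSum.mapL (ContinuousLinearMap.apply ℂ X x))
    have h2 := hasSum_single (f := fun m ↦ f.coord n (F m z x)) n fun m hm ↦ by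
      simp only [F]
      rw [_root_.smul_apply, map_smul, coord_mult hf (isPairBounded_single m)]
      simp [hm.symm]
    rw [h1.unique h2, coord_expMult hb hf (hδ0.trans hz')]
    simp only [F]
    rw [_root_.smul_apply, map_smul, coord_mult hf (isPairBounded_single n)]
    simp
  have hmem : z₀ ∈ {z : ℂ | δ < z.re} := by
    change δ < z₀.re
    rw [hδ]
    linarith
  exact ((hd.congr heq).differentiableAt (hU.mem_nhds hmem)).differentiableWithinAt

include hb hf in
theorem isAnalyticC0Semigroup_expMult [CompleteSpace X] :
    IsAnalyticC0Semigroup fun t : ℝ ↦ expMult f b t := by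
  refine ⟨isC0Semigroup_expMult hb hf, Real.pi / 2, ⟨by positivity, le_rfl⟩, expMult f b,
    fun t _ ↦ rfl, fun z hz w hw ↦ ?_, ?_, fun θ hθ x ↦ ?_⟩
  · have hz' := re_pos_of_mem_sector hz
    have hw' := re_pos_of_mem_sector hw
    ext x
    refine ext_coord f fun m ↦ ?_
    rw [ContinuousLinearMap.comp_apply, coord_expMult hb hf hz', coord_expMult hb hf hw',
      coord_expMult hb hf (by rw [Complex.add_re]; exact add_pos hz' hw'), ← mul_assoc,
      ← Complex.exp_add, mul_add]
  · exact (differentiableOn_expMult hb hf).mono fun z hz ↦ re_pos_of_mem_sector hz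
  · have hcos : 0 < Real.cos θ :=
      Real.cos_pos_of_mem_Ioo ⟨by linarith [hθ.1, Real.pi_pos], hθ.2⟩
    refine tendsto_mult hf (B := 1) (S := (2 / Real.cos θ) ^ 2 * (4 / 3)) ?_
      (fun m ↦ tendsto_exp_mul_one _) x
    filter_upwards [self_mem_nhdsWithin] with z hz
    refine isPairBounded_exp hcos (by linarith [Real.cos_le_one θ]) hz.1 ?_ hb
    rw [mul_comm]
    exact norm_mul_cos_le_of_mem_closure (by linarith [hθ.2, Real.pi_pos]) (subset_closure hz)

include hb hf in
/-- On the domain of `A`, the difference quotients of the semigroup are `-A` followed by multipliers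
that converge strongly to the identity; conversely, the limit of difference quotients is determined
by its coordinates. -/
theorem isGeneratorOf_expMult :
    IsGeneratorOf (-multOp f (rate b)) fun t : ℝ ↦ expMult f b t := by
  intro x y
  have hgraph : (x, y) ∈ (-multOp f (rate b)).graph ↔ (x, -y) ∈ (multOp f (rate b)).graph := by
    simp only [LinearPMap.mem_graph_iff, LinearPMap.neg_apply]
    constructor
    · rintro ⟨z, h1, h2⟩
      exact ⟨z, h1, by rw [← h2, neg_neg]⟩
    · rintro ⟨z, h1, h2⟩
      exact ⟨z, h1, by rw [h2, neg_neg]⟩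
  rw [hgraph, mem_graph_multOp]
  constructor
  · intro h
    have hlim := tendsto_mult hf (l := 𝓝[>] (0 : ℝ)) (B := 1) (S := 2 * (4 / 3))
      (c := fun t m ↦ (((1 - Real.exp (-(rate b m * t))) / (rate b m * t) : ℝ) : ℂ)) ?_ ?_ y
    · refine hlim.congr' ?_
      filter_upwards [self_mem_nhdsWithin] with t ht
      have ht0 : 0 < t := ht
      refine ext_coord f fun m ↦ ?_
      have hm := h m
      rw [map_neg, neg_eq_iff_eq_neg] at hm
      rw [coord_mult hf (isPairBounded_quotient ht0 hb), map_smul, map_sub,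
        coord_expMult_real hb hf ht0.le, hm, smul_eq_mul]
      have hr : (rate b m : ℂ) ≠ 0 := by exact_mod_cast (rate_pos b m).ne'
      have htc : (t : ℂ) ≠ 0 := by exact_mod_cast ht0.ne'
      push_cast
      field_simp
      ring
    · filter_upwards [self_mem_nhdsWithin] with t ht using isPairBounded_quotient ht hb
    · intro m
      have hd : HasDerivAt (fun t : ℝ ↦ 1 - Real.exp (-(rate b m * t))) (rate b m) 0 := by
        have h1 : HasDerivAt (fun t : ℝ ↦ -(rate b m * t)) (-(rate b m * 1)) 0 :=
          ((hasDerivAt_id (0 : ℝ)).const_mul (rate b m)).neg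
        simpa using (h1.exp.const_sub 1)
      have h2 := hd.tendsto_slope_zero_right
      have h3 := (Complex.continuous_ofReal.tendsto _).comp (h2.mul_const (rate b m)⁻¹)
      rw [mul_inv_cancel₀ (rate_pos b m).ne', Complex.ofReal_one] at h3
      refine h3.congr fun t ↦ ?_
      simp only [Function.comp_apply, zero_add, mul_zero, neg_zero, Real.exp_zero, sub_self,
        sub_zero, smul_eq_mul]
      congr 1
      rw [div_eq_mul_inv, mul_inv]
      ring
  · intro h m
    have h1 := ((f.coord m).continuous.tendsto y).comp h
    have hd : HasDerivAt (fun t : ℝ ↦ Complex.exp (-(rate b m : ℂ) * t) * f.coord m x)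
        (-(rate b m : ℂ) * f.coord m x) 0 := by
      have h1 : HasDerivAt (fun t : ℝ ↦ -(rate b m : ℂ) * t) (-(rate b m : ℂ)) 0 := by
        simpa using (Complex.ofRealCLM.hasDerivAt (x := (0 : ℝ))).const_mul (-(rate b m : ℂ))
      simpa using h1.cexp.mul_const (f.coord m x)
    have h2 := hd.tendsto_slope_zero_right
    have h3 := tendsto_nhds_unique (h1.congr' ?_) h2
    · rw [map_neg, h3]; ring
    · filter_upwards [self_mem_nhdsWithin] with t ht
      simp only [Function.comp_apply, map_smul, map_sub, zero_add, Complex.ofReal_zero, mul_zero,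
        Complex.exp_zero, one_mul]
      rw [coord_expMult_real hb hf (Set.mem_Ioi.1 ht).le]
      simp

end Semigroup

section Counterexample

variable {X : Type*} [NormedAddCommGroup X] [NormedSpace ℂ X] {e : SchauderBasis ℂ X}

/-! ### Failure of R-boundedness -/

theorem ae_rademacher_eq (k : ℕ) : ∀ᵐ t : ℝ, rademacher k t = 1 ∨ rademacher k t = -1 := by
  have hc : {t : ℝ | Real.sin (2 ^ k * Real.pi * t) = 0}.Countable := by
    refine (Set.countable_range fun n : ℤ ↦ (n : ℝ) / 2 ^ k).mono ?_
    intro t ht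
    obtain ⟨n, hn⟩ := Real.sin_eq_zero_iff.1 ht
    refine ⟨n, ?_⟩
    have hπ := Real.pi_ne_zero
    have h2 : (n : ℝ) = 2 ^ k * t := mul_right_cancel₀ hπ (by rw [hn]; ring)
    simp only
    rw [h2]
    field_simp
  filter_upwards [hc.ae_notMem volume] with t ht
  rcases Real.sign_apply_eq (Real.sin (2 ^ k * Real.pi * t)) with h | h | h
  · exact Or.inr h
  · exact (ht (Real.sign_eq_zero_iff.1 h)).elim
  · exact Or.inl h

theorem norm_sum_sign_subseq (he : IsOneUnconditional e) {n : ℕ} {i : ℕ → ℕ}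
    (hi : Function.Injective i) (a ε : Fin n → ℂ) (hε : ∀ k, ε k = 1 ∨ ε k = -1) :
    ‖∑ k, (ε k * a k) • e (i k)‖ = ‖∑ k, a k • e (i k)‖ := by
  have hj : Function.Injective fun k : Fin n ↦ i k := hi.comp Fin.val_injective
  have h := he (Finset.univ.map ⟨_, hj⟩) (Function.extend (fun k : Fin n ↦ i k) a 0)
    (Function.extend (fun k : Fin n ↦ i k) ε 1) (fun m ↦ by
      by_cases hm : ∃ k : Fin n, i k = m
      · obtain ⟨k, rfl⟩ := hm
        rw [hj.extend_apply ε 1 k]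
        exact hε k
      · rw [Function.extend_apply' _ _ _ hm]
        exact Or.inl rfl)
  rw [Finset.sum_map, Finset.sum_map] at h
  have h1 := fun k ↦ hj.extend_apply a 0 k
  have h2 := fun k ↦ hj.extend_apply ε 1 k
  simpa only [Function.Embedding.coeFn_mk, h1, h2] using h

/-- Signs do not matter for multiples of vectors of an unconditional basis, so their Rademacher
norm is the norm of their sum. -/
theorem rademacherNorm_basis (he : IsOneUnconditional e) {n : ℕ} {i : ℕ → ℕ}
    (hi : Function.Injective i) (a : Fin n → ℂ) :
    rademacherNorm (fun k : Fin n ↦ a k • e (i k)) = ‖∑ k, a k • e (i k)‖ₑ := by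
  have hsign : ∀ᵐ t ∂(volume.restrict (Set.Icc (0 : ℝ) 1)), ∀ k : Fin n,
      rademacher ((k : ℕ) + 1) t = 1 ∨ rademacher ((k : ℕ) + 1) t = -1 :=
    ae_all_iff.2 fun k ↦ ae_restrict_of_ae (ae_rademacher_eq _)
  rw [rademacherNorm, eLpNorm_congr_norm_ae (g := fun _ ↦ ∑ k, a k • e (i k))]
  · rw [eLpNorm_const' _ two_ne_zero ENNReal.ofNat_ne_top]
    simp
  · filter_upwards [hsign] with t ht
    simp only [smul_smul]
    refine norm_sum_sign_subseq he hi a _ fun k ↦ ?_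
    rcases ht k with h | h <;> simp [h]

/-- The projection onto the closed span of the `e (u k)` along the `e (v k)`. -/
theorem exists_projection [CompleteSpace X] (he : IsOneUnconditional e) {u v : ℕ → ℕ}
    (huv : IsSplitting u v) :
    ∃ D : X →L[ℂ] X, ‖D‖ ≤ 2 ∧ (∀ k, D (e (u k)) = e (u k)) ∧ ∀ k, D (e (v k)) = 0 := by
  classical
  obtain ⟨D, hD, hn⟩ := exists_diagonal he (fun n ↦ if n ∈ Set.range u then 1 else 0) (B := 1)
    (fun n ↦ by split_ifs <;> simp)
  have hbasis : ∀ m, D (e m) = (if m ∈ Set.range u then (1 : ℂ) else 0) • e m := fun m ↦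
    ext_coord e fun n ↦ by
      rw [hD, map_smul, smul_eq_mul]
      by_cases h : n = m
      · rw [h]
      · rw [coord_ne e h, mul_zero, mul_zero]
  refine ⟨D, by linarith, fun k ↦ ?_, fun k ↦ ?_⟩
  · rw [hbasis, if_pos ⟨k, rfl⟩, one_smul]
  · rw [hbasis, if_neg (by rintro ⟨l, hl⟩; exact huv.ne _ _ hl), zero_smul]

theorem resolvent_basis {f : SchauderBasis ℂ X} {γ : ℕ → ℝ} {z : ℂ} {R : X →L[ℂ] X}
    (hR : IsResolventAt (multOp f γ) z R) {m : ℕ} (hz : z - γ m ≠ 0) :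
    R (f m) = (z - γ m)⁻¹ • f m := by
  obtain ⟨h, h'⟩ := mem_domain_multOp (f := f) (γ := γ) (x := f m) (y := (γ m : ℂ) • f m) fun n ↦ by
    rw [map_smul, smul_eq_mul]
    by_cases h : n = m
    · rw [h]
    · rw [coord_ne f h, mul_zero, mul_zero]
  have := hR.2 ⟨f m, h⟩
  rw [h', ← sub_smul, map_smul] at this
  exact (eq_inv_smul_iff₀ hz).2 this

variable [CompleteSpace X] (he : IsOneUnconditional e) (hn : IsNormalized e)
  {u v : ℕ → ℕ} (huv : IsSplitting u v) {b : ℕ} (hb : b ≤ 1) {c : ℕ → ℂ}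

/-- At `z = -4 ^ k` the operator `z R(z, A)` maps `e (v k)` to a vector with a component along
`e (u k)` whose size does not depend on `k`. -/
theorem resolvent_apply_right {k : ℕ} {R : X →L[ℂ] X}
    (hR : IsResolventAt (multOp (perturbedBasis he hn huv b hb) (rate b)) (-((4 ^ k : ℝ) : ℂ)) R) :
    ((-((4 ^ k : ℝ) : ℂ)) • R) (e (v k)) = (1 / 2 : ℂ) • e (v k) + (1 / 6 : ℂ) • e (u k) := by
  have h4 : ((4 : ℂ) ^ k) ≠ 0 := by positivity
  have hP : (-((4 ^ k : ℝ) : ℂ)) - (rate b (2 * k + b) : ℂ) = -(3 * 4 ^ k) := by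
    rw [rate_left hb]; push_cast; ring
  have hQ : (-((4 ^ k : ℝ) : ℂ)) - (rate b (2 * k + (1 - b)) : ℂ) = -(2 * 4 ^ k) := by
    rw [rate_right hb]; push_cast; ring
  have h1 := resolvent_basis hR (m := 2 * k + b) (by rw [hP]; simp)
  have h2 := resolvent_basis hR (m := 2 * k + (1 - b)) (by rw [hQ]; simp)
  rw [hP, perturbedBasis_left] at h1
  rw [hQ, perturbedBasis_right, map_add, h1, ← eq_sub_iff_add_eq'] at h2
  rw [_root_.smul_apply, h2, smul_sub, smul_smul, smul_smul]
  have e1 : -((4 ^ k : ℝ) : ℂ) * (-(2 * 4 ^ k))⁻¹ = 1 / 2 := by push_cast; field_simp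
  have e2 : -((4 ^ k : ℝ) : ℂ) * (-(3 * 4 ^ k))⁻¹ = 1 / 3 := by push_cast; field_simp
  rw [e1, e2]
  module

/-- R-sectoriality would imply that convergence of a series along `e (v k)` entails convergence of
the series with the same coefficients along `e (u k)`. -/
theorem not_isRSectorial (hv : Summable fun k ↦ c k • e (v k))
    (hu : ¬ Summable fun k ↦ c k • e (u k)) :
    ¬ IsRSectorial (multOp (perturbedBasis he hn huv b hb) (rate b)) := by
  have hf := hasPairMultipliers_perturbedBasis he hn huv b hb
  rintro ⟨-, ω, hω, hωπ, C, hC⟩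
  rw [sectorialAngle_multOp hb hf] at hω
  obtain ⟨_, hres⟩ := exists_resolvent_bound hb hf hω
  have hz : ∀ k : ℕ, (-((4 ^ k : ℝ) : ℂ)) ∉ closure (sector ω) := fun k ↦
    neg_notMem_closure_sector hωπ hω (by positivity)
  choose R hR _ using fun k ↦ hres _ (hz k)
  obtain ⟨D, hD, hDu, hDv⟩ := exists_projection he huv
  have key : ∀ (n : ℕ) (a : Fin n → ℂ),
      ‖∑ k, a k • e (u k)‖ ≤ 12 * C * ‖∑ k, a k • e (v k)‖ := by
    intro n a
    have h1 := hC n (fun k ↦ (-((4 ^ (k : ℕ) : ℝ) : ℂ)) • R k) (fun k ↦ a k • e (v k))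
      (fun k ↦ ⟨_, hz k, R k, hR k, rfl⟩)
    rw [rademacherNorm_basis he huv.injective_right] at h1
    simp only [map_smul, resolvent_apply_right he hn huv hb (hR _)] at h1
    -- The projection onto the span of the `e (u k)` recovers their component.
    have h2 : rademacherNorm (fun k : Fin n ↦ a k • e (u k)) ≤ (12 : ℝ≥0) •
        rademacherNorm fun k : Fin n ↦ a k • ((1 / 2 : ℂ) • e (v k) + (1 / 6 : ℂ) • e (u k)) := by
      refine eLpNorm_le_nnreal_smul_eLpNorm_of_ae_le_mul (Eventually.of_forall fun t ↦ ?_) 2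
      set y := ∑ k : Fin n, (rademacher ((k : ℕ) + 1) t : ℂ) •
        a k • ((1 / 2 : ℂ) • e (v k) + (1 / 6 : ℂ) • e (u k)) with hy
      have hDy : ∑ k : Fin n, (rademacher ((k : ℕ) + 1) t : ℂ) • a k • e (u k) = (6 : ℂ) • D y := by
        rw [hy, map_sum, Finset.smul_sum]
        refine Finset.sum_congr rfl fun k _ ↦ ?_
        simp only [map_smul, map_add, hDu, hDv]
        module
      rw [hDy, ← NNReal.coe_le_coe]
      push_cast
      rw [norm_smul]
      have := (D.le_opNorm y).trans (mul_le_mul_of_nonneg_right hD (norm_nonneg y))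
      simp only [Complex.norm_ofNat]
      linarith
    rw [rademacherNorm_basis he huv.injective_left] at h2
    have h3 : ‖∑ k, a k • e (u k)‖ₑ ≤ ((12 * C * ‖∑ k, a k • e (v k)‖₊ : ℝ≥0) : ℝ≥0∞) := by
      refine h2.trans ?_
      rw [ENNReal.smul_def, smul_eq_mul, mul_assoc, ENNReal.coe_mul, ENNReal.coe_mul]
      exact mul_le_mul_right h1 _
    rw [enorm_eq_nnnorm, ENNReal.coe_le_coe, ← NNReal.coe_le_coe] at h3
    simpa using h3
  have key' : ∀ s : Finset ℕ, ‖∑ k ∈ s, c k • e (u k)‖ ≤ 12 * C * ‖∑ k ∈ s, c k • e (v k)‖ := by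
    intro s
    obtain ⟨n, hsn⟩ := s.exists_nat_subset_range
    have hsum : ∀ i : ℕ → ℕ, ∑ k : Fin n, (if (k : ℕ) ∈ s then c k else 0) • e (i k) =
        ∑ k ∈ s, c k • e (i k) := fun i ↦ by
      rw [Fin.sum_univ_eq_sum_range (fun k ↦ (if k ∈ s then c k else 0) • e (i k)) n,
        ← Finset.sum_subset hsn fun k _ hk ↦ by simp [hk]]
      exact Finset.sum_congr rfl fun k hk ↦ by simp [hk]
    have := key n fun k ↦ if (k : ℕ) ∈ s then c k else 0
    rwa [hsum, hsum] at this
  refine hu (summable_iff_vanishing_norm.2 fun ε hε ↦ ?_)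
  obtain ⟨s, hs⟩ := summable_iff_vanishing_norm.1 hv (ε / (12 * C + 1)) (by positivity)
  refine ⟨s, fun t ht ↦ (key' t).trans_lt ?_⟩
  have h1 := hs t ht
  rw [lt_div_iff₀ (by positivity)] at h1
  have := norm_nonneg (∑ k ∈ t, c k • e (v k))
  nlinarith

/-! ### Positivity -/

theorem coord_left_eq (k : ℕ) (x : X) :
    e.coord (u k) x = (perturbedBasis he hn huv b hb).coord (2 * k + b) x +
      (perturbedBasis he hn huv b hb).coord (2 * k + (1 - b)) x := by
  rw [coord_perturbedBasis_left, coord_perturbedBasis_right, sub_add_cancel]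

/-- On each pair the semigroup is a triangular matrix, whose off-diagonal entry is positive because
the perturbed vector carries the smaller exponent. -/
theorem isPositiveSemigroup_expMult : IsPositiveSemigroup (basisCone e)
    fun t : ℝ ↦ expMult (perturbedBasis he hn huv b hb) b t := by
  have hf := hasPairMultipliers_perturbedBasis he hn huv b hb
  intro t ht x hx n
  have hexp : ∀ m, Complex.exp (-(rate b m : ℂ) * t) = ((Real.exp (-(rate b m * t)) : ℝ) : ℂ) :=
    fun m ↦ by push_cast; congr 1; ring
  rcases huv.cover n with ⟨k, rfl⟩ | ⟨k, rfl⟩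
  · rw [coord_left_eq he hn huv hb, coord_expMult_real hb hf ht, coord_expMult_real hb hf ht,
      coord_perturbedBasis_left, coord_perturbedBasis_right, hexp, hexp, rate_left hb,
      rate_right hb]
    have h1 : (0 : ℂ) ≤ ((Real.exp (-(2 * 4 ^ k * t)) : ℝ) : ℂ) * e.coord (u k) x :=
      mul_nonneg (Complex.zero_le_real.2 (Real.exp_nonneg _)) (hx _)
    have h2 : (0 : ℂ) ≤ ((Real.exp (-(4 ^ k * t)) - Real.exp (-(2 * 4 ^ k * t)) : ℝ) : ℂ) *
        e.coord (v k) x := by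
      refine mul_nonneg (Complex.zero_le_real.2 (sub_nonneg.2 (Real.exp_le_exp.2 ?_))) (hx _)
      have : 0 ≤ 4 ^ k * t := by positivity
      linarith
    convert add_nonneg h1 h2 using 1
    push_cast
    ring
  · rw [← coord_perturbedBasis_right he hn huv b hb, coord_expMult_real hb hf ht,
      coord_perturbedBasis_right, hexp]
    exact mul_nonneg (Complex.zero_le_real.2 (Real.exp_nonneg _)) (hx _)

/-! ### Failure of maximal regularity -/

omit [CompleteSpace X] in
/-- A function with continuous coordinates is the pointwise limit of its continuous partial sums. -/
theorem stronglyMeasurable_of_continuous_coord (f : SchauderBasis ℂ X) {g : ℝ → X}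
    (hg : ∀ n, Continuous fun s ↦ f.coord n (g s)) : StronglyMeasurable g := by
  refine stronglyMeasurable_of_tendsto (u := atTop)
    (f := fun N s ↦ ∑ n ∈ Finset.range N, f.coord n (g s) • f n) (fun N ↦ ?_) ?_
  · exact (continuous_finsetSum _ fun n _ ↦ (hg n).smul continuous_const).stronglyMeasurable
  · exact tendsto_pi_nhds.2 fun s ↦ hasSum_conditional_iff.1 (f.expansion (g s))

theorem integral_exp_convolution {α β t : ℝ} (hα : 0 < α) :
    ∫ s in (0 : ℝ)..t, Complex.exp (-(α : ℂ) * ((t - s : ℝ) : ℂ)) *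
        Complex.exp (β * Complex.I * s) =
      (Complex.exp (β * Complex.I * t) - Complex.exp (-(α * t : ℝ))) / (α + β * Complex.I) := by
  have hne : (α : ℂ) + β * Complex.I ≠ 0 := fun h ↦ by
    have := congrArg Complex.re h
    simp at this
    exact hα.ne' this
  have h1 : ∀ s : ℝ, Complex.exp (-(α : ℂ) * ((t - s : ℝ) : ℂ)) * Complex.exp (β * Complex.I * s) =
      Complex.exp (-(α * t : ℝ)) * Complex.exp ((α + β * Complex.I) * s) := fun s ↦ by
    rw [← Complex.exp_add, ← Complex.exp_add]
    congr 1
    push_cast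
    ring
  simp only [h1]
  rw [intervalIntegral.integral_const_mul, integral_exp_mul_complex hne, mul_div_assoc', mul_sub,
    ← Complex.exp_add]
  simp only [Complex.ofReal_zero, mul_zero, Complex.exp_zero, mul_one]
  congr 3
  push_cast
  ring

/-- The component of `A ∫ T(t - s) g(s) ds` along `e (u k)` for `g(s) = exp (i 4 ^ k s) e (v k)`, as a
function of `x = 4 ^ k t`. -/
noncomputable def responseFactor (x : ℝ) : ℂ :=
  (Complex.exp (x * Complex.I) - Complex.exp (-(x : ℝ))) / (1 + Complex.I) -
    2 * ((Complex.exp (x * Complex.I) - Complex.exp (-(2 * x : ℝ))) / (2 + Complex.I))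

/-- Up to exponentially small terms, the response factor has the constant modulus
`|(3 + i) / 10| > 3 / 10`. -/
theorem eventually_norm_responseFactor_ge : ∀ᶠ x in atTop, 1 / 5 ≤ ‖responseFactor x‖ := by
  have hlim : Tendsto (fun x : ℝ ↦ Real.exp (-x)) atTop (𝓝 0) :=
    Real.tendsto_exp_neg_atTop_nhds_zero
  filter_upwards [hlim.eventually_le_const (show (0 : ℝ) < 1 / 20 by norm_num),
    eventually_ge_atTop 0] with x hx hx0
  have h1 : (1 + Complex.I) ≠ 0 := fun h ↦ by simpa using congrArg Complex.re h
  have h2 : (2 + Complex.I) ≠ 0 := fun h ↦ by simpa using congrArg Complex.re h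
  have hid : responseFactor x = Complex.exp (x * Complex.I) * (-(3 + Complex.I) / 10) -
      Complex.exp (-(x : ℝ)) / (1 + Complex.I) +
      2 * (Complex.exp (-(2 * x : ℝ)) / (2 + Complex.I)) := by
    have h3 : (1 + Complex.I)⁻¹ - 2 * (2 + Complex.I)⁻¹ = -(3 + Complex.I) / 10 := by
      field_simp
      ring_nf
      rw [show Complex.I ^ 3 = -Complex.I by rw [pow_succ, Complex.I_sq]; ring, Complex.I_sq]
      ring
    rw [← h3, responseFactor]
    simp only [div_eq_mul_inv]
    ring
  have n1 : 1 ≤ ‖1 + Complex.I‖ := by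
    simpa using Complex.abs_re_le_norm (1 + Complex.I)
  have n2 : 2 ≤ ‖2 + Complex.I‖ := by
    simpa using Complex.abs_re_le_norm (2 + Complex.I)
  have n3 : 3 / 10 ≤ ‖Complex.exp (x * Complex.I) * (-(3 + Complex.I) / 10)‖ := by
    rw [norm_mul, Complex.norm_exp_ofReal_mul_I, one_mul, norm_div, norm_neg]
    have : 3 ≤ ‖3 + Complex.I‖ := by simpa using Complex.abs_re_le_norm (3 + Complex.I)
    simp only [Complex.norm_ofNat]
    linarith
  have n4 : ‖Complex.exp (-(x : ℝ)) / (1 + Complex.I)‖ ≤ 1 / 20 := by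
    rw [norm_div, Complex.norm_exp, div_le_iff₀ (by linarith)]
    simp only [Complex.neg_re, Complex.ofReal_re]
    nlinarith
  have n5 : ‖2 * (Complex.exp (-(2 * x : ℝ)) / (2 + Complex.I))‖ ≤ 1 / 20 := by
    rw [norm_mul, norm_div, Complex.norm_exp]
    simp only [Complex.neg_re, Complex.ofReal_re, Complex.norm_ofNat]
    have : Real.exp (-(2 * x)) ≤ Real.exp (-x) := Real.exp_le_exp.2 (by linarith)
    rw [mul_div_assoc', div_le_iff₀ (by linarith)]
    nlinarith
  rw [hid]
  set A := Complex.exp (x * Complex.I) * (-(3 + Complex.I) / 10)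
  set B := Complex.exp (-(x : ℝ)) / (1 + Complex.I)
  set C := 2 * (Complex.exp (-(2 * x : ℝ)) / (2 + Complex.I))
  have h5 : A = (A - B + C) + B - C := by ring
  have h6 : ‖A‖ ≤ ‖A - B + C‖ + ‖B‖ + ‖C‖ := by
    conv_lhs => rw [h5]
    exact (norm_sub_le _ _).trans (add_le_add_left (norm_add_le _ _) _)
  linarith

include hb in
/-- Coordinate functionals may be taken inside the integral defining a mild solution, as the
integrand is measurable and bounded. -/
theorem coord_mildSolution {f : SchauderBasis ℂ X} (hf : HasPairMultipliers f)
    {g : ℝ → X} {G : ℝ} (hgG : ∀ s, ‖g s‖ ≤ G) (hg : ∀ n, Continuous fun s ↦ f.coord n (g s))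
    {t : ℝ} (ht : 0 ≤ t) (m : ℕ) :
    f.coord m (mildSolution (fun t : ℝ ↦ expMult f b t) g t) =
      ∫ s in (0 : ℝ)..t, Complex.exp (-(rate b m : ℂ) * ((t - s : ℝ) : ℂ)) * f.coord m (g s) := by
  have hG : 0 ≤ G := (norm_nonneg _).trans (hgG 0)
  -- Truncation at zero makes the integrand measurable on the whole line.
  let h : ℝ → X := fun s ↦ expMult f b ((max (t - s) 0 : ℝ) : ℂ) (g s)
  have hcoord : ∀ n s, f.coord n (h s) =
      Complex.exp (-(rate b n : ℂ) * ((max (t - s) 0 : ℝ) : ℂ)) * f.coord n (g s) := fun n s ↦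
    coord_expMult_real hb hf (le_max_right _ _) n (g s)
  have hmeas : StronglyMeasurable h := stronglyMeasurable_of_continuous_coord f fun n ↦ by
    simp only [hcoord]
    have := hg n
    fun_prop
  have hbound : ∀ s, ‖h s‖ ≤ (2 * 1 + 2 ^ 2 * (4 / 3)) * G := fun s ↦
    (ContinuousLinearMap.le_opNorm _ _).trans
      (mul_le_mul (norm_mult_le hf (isPairBounded_exp_real hb (le_max_right _ _))) (hgG s)
        (norm_nonneg _) (by norm_num))
  have hint : IntervalIntegrable h volume 0 t := by
    rw [intervalIntegrable_iff_integrableOn_Ioc_of_le ht]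
    exact Measure.integrableOn_of_bounded (by simp) hmeas.aestronglyMeasurable
      (Eventually.of_forall hbound)
  have heq : mildSolution (fun t : ℝ ↦ expMult f b t) g t = ∫ s in (0 : ℝ)..t, h s := by
    refine intervalIntegral.integral_congr fun s hs ↦ ?_
    rw [Set.uIcc_of_le ht] at hs
    simp only [h, max_eq_left (sub_nonneg.2 hs.2)]
  rw [heq, ← ContinuousLinearMap.intervalIntegral_comp_comm _ hint]
  refine intervalIntegral.integral_congr fun s hs ↦ ?_
  rw [Set.uIcc_of_le ht] at hs
  simp only [hcoord, max_eq_left (sub_nonneg.2 hs.2)]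

/-- For the forcing term `∑ c k * exp (i 4 ^ k s) • e (v k)`, the mild solution is outside the domain
of the multiplier at every positive time. -/
theorem not_hasMaximalRegularity (hv : Summable fun k ↦ c k • e (v k))
    (hu : ¬ Summable fun k ↦ c k • e (u k)) :
    ¬ HasMaximalRegularity (multOp (perturbedBasis he hn huv b hb) (rate b))
      fun t : ℝ ↦ expMult (perturbedBasis he hn huv b hb) b t := by
  have hf := hasPairMultipliers_perturbedBasis he hn huv b hb
  set f := perturbedBasis he hn huv b hb with hfdef
  obtain ⟨x₀, hx₀⟩ := hv
  have hxv : ∀ k, e.coord (v k) x₀ = c k := coord_of_hasSum_subseq e huv.injective_right hx₀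
  have hxu : ∀ k, e.coord (u k) x₀ = 0 := fun k ↦
    coord_eq_zero_of_hasSum_subseq e hx₀ fun l ↦ (huv.ne k l).symm
  -- The forcing term `g s` rotates the coefficient at `e (v k)` with frequency `4 ^ k`.
  let θ : ℕ → ℝ := Function.extend v (fun k ↦ 4 ^ k) 0
  have hθ : ∀ k, θ (v k) = 4 ^ k := fun k ↦ huv.injective_right.extend_apply _ _ _
  choose D hD hDn using fun s : ℝ ↦ exists_diagonal he
    (fun n ↦ Complex.exp (((θ n * s : ℝ) : ℂ) * Complex.I)) (B := 1)
    (fun n ↦ (Complex.norm_exp_ofReal_mul_I _).le)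
  let g : ℝ → X := fun s ↦ D s x₀
  have hgv : ∀ k s, e.coord (v k) (g s) =
      Complex.exp (((4 ^ k : ℝ) : ℂ) * Complex.I * s) * c k := fun k s ↦ by
    rw [hD, hxv, hθ]
    congr 2
    push_cast
    ring
  have hgu : ∀ k s, e.coord (u k) (g s) = 0 := fun k s ↦ by rw [hD, hxu, mul_zero]
  have hgG : ∀ s, ‖g s‖ ≤ 2 * 1 * ‖x₀‖ := fun s ↦
    (ContinuousLinearMap.le_opNorm _ _).trans
      (mul_le_mul_of_nonneg_right (hDn s) (norm_nonneg _))
  have hgP : ∀ k s, f.coord (2 * k + b) (g s) =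
      -(Complex.exp (((4 ^ k : ℝ) : ℂ) * Complex.I * s) * c k) := fun k s ↦ by
    rw [hfdef, coord_perturbedBasis_left, hgu, hgv, zero_sub]
  have hgQ : ∀ k s, f.coord (2 * k + (1 - b)) (g s) =
      Complex.exp (((4 ^ k : ℝ) : ℂ) * Complex.I * s) * c k := fun k s ↦ by
    rw [hfdef, coord_perturbedBasis_right, hgv]
  have hgc : ∀ n, Continuous fun s ↦ f.coord n (g s) := fun n ↦ by
    by_cases h : n % 2 = b
    · rw [show n = 2 * (n / 2) + b by omega]
      simp only [hgP]
      fun_prop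
    · rw [show n = 2 * (n / 2) + (1 - b) by omega]
      simp only [hgQ]
      fun_prop
  rintro ⟨τ, hτ, r, -, -, hreg⟩
  have hgLp : MemLp g r (volume.restrict (Set.Icc 0 τ)) :=
    MemLp.of_bound (stronglyMeasurable_of_continuous_coord f hgc).aestronglyMeasurable _
      (Eventually.of_forall hgG)
  obtain ⟨-, -, w, -, hw⟩ := hreg g hgLp
  obtain ⟨t, ht, y, hy⟩ : ∃ t : ℝ, 0 < t ∧ ∃ y,
      (mildSolution (fun t : ℝ ↦ expMult f b t) g t, y) ∈ (multOp f (rate b)).graph := by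
    have : NeBot (ae (volume.restrict (Set.Icc 0 τ))) := by
      rw [ae_neBot]
      intro h
      have := congrArg (fun μ : Measure ℝ ↦ μ Set.univ) h
      simp [hτ.not_ge] at this
    have h0 : ∀ᵐ t ∂(volume.restrict (Set.Icc 0 τ)), t ≠ 0 :=
      ae_restrict_of_ae (Measure.ae_ne volume 0)
    obtain ⟨t, ht, ht0, htw⟩ := ((ae_restrict_mem measurableSet_Icc).and (h0.and hw)).exists
    exact ⟨t, lt_of_le_of_ne ht.1 (Ne.symm ht0), w t, htw⟩
  rw [mem_graph_multOp] at hy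
  have hyu : ∀ k, e.coord (u k) y = responseFactor (4 ^ k * t) * c k := fun k ↦ by
    have h4 : (0 : ℝ) < 4 ^ k := by positivity
    have h4' : ((4 : ℂ) ^ k) ≠ 0 := by positivity
    have h1 : (1 + Complex.I) ≠ 0 := fun h ↦ by simpa using congrArg Complex.re h
    have h2 : (2 + Complex.I) ≠ 0 := fun h ↦ by simpa using congrArg Complex.re h
    rw [coord_left_eq he hn huv hb, ← hfdef, hy, hy, coord_mildSolution hb hf hgG hgc ht.le,
      coord_mildSolution hb hf hgG hgc ht.le, rate_left hb, rate_right hb]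
    simp only [hgP, hgQ, mul_neg, ← mul_assoc]
    rw [intervalIntegral.integral_neg, intervalIntegral.integral_mul_const,
      intervalIntegral.integral_mul_const, integral_exp_convolution h4,
      integral_exp_convolution (by positivity : (0 : ℝ) < 2 * 4 ^ k), responseFactor]
    have d1 : (((4 ^ k : ℝ) : ℂ) + ((4 ^ k : ℝ) : ℂ) * Complex.I) = 4 ^ k * (1 + Complex.I) := by
      push_cast; ring
    have d2 : (((2 * 4 ^ k : ℝ) : ℂ) + ((4 ^ k : ℝ) : ℂ) * Complex.I) =
        4 ^ k * (2 + Complex.I) := by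
      push_cast; ring
    have d3 : ((4 ^ k : ℝ) : ℂ) * Complex.I * t = ((4 ^ k * t : ℝ) : ℂ) * Complex.I := by
      push_cast; ring
    have d4 : 2 * (4 : ℝ) ^ k * t = 2 * (4 ^ k * t) := by ring
    rw [d1, d2, d3, d4]
    generalize Complex.exp (((4 ^ k * t : ℝ) : ℂ) * Complex.I) = E
    generalize Complex.exp (-((4 ^ k * t : ℝ) : ℂ)) = E1
    generalize Complex.exp (-((2 * (4 ^ k * t) : ℝ) : ℂ)) = E2
    push_cast
    field_simp
    ring
  -- Division by the response factors, which are eventually bounded below, preserves convergence.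
  have hlim : Tendsto (fun k : ℕ ↦ (4 : ℝ) ^ k * t) atTop atTop :=
    (tendsto_pow_atTop_atTop_of_one_lt (by norm_num)).atTop_mul_const ht
  have hev := hlim.eventually eventually_norm_responseFactor_ge
  classical
  let q : ℕ → ℂ := fun k ↦
    if 1 / 5 ≤ ‖responseFactor (4 ^ k * t)‖ then (responseFactor (4 ^ k * t))⁻¹ else 0
  have hq : ∀ k, ‖q k‖ ≤ 5 := fun k ↦ by
    simp only [q]
    split_ifs with h
    · rw [norm_inv]
      exact (inv_anti₀ (by norm_num) h).trans (by norm_num)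
    · simp
  obtain ⟨D', hD', -⟩ := exists_diagonal he (Function.extend u q 0) (B := 5) fun n ↦ by
    by_cases h : ∃ k, u k = n
    · obtain ⟨k, rfl⟩ := h
      rw [huv.injective_left.extend_apply]
      exact hq k
    · rw [Function.extend_apply' _ _ _ h]
      simp
  have hsum : Summable fun k ↦ e.coord (u k) (D' y) • e (u k) :=
    (summable_iff_exists_coord_subseq he huv.injective_left).2 ⟨D' y, fun _ ↦ rfl⟩
  refine hu (hsum.congr_atTop ?_)
  filter_upwards [hev] with k hk
  rw [hD', huv.injective_left.extend_apply, hyu]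
  have hne : responseFactor (4 ^ k * t) ≠ 0 := by
    intro h
    rw [h, norm_zero] at hk
    norm_num at hk
  simp only [q, if_pos hk]
  rw [inv_mul_cancel_left₀ hne]

include he hn in
/-- Every non-symmetric unconditional basis admits a perturbation with a multiplier of the required
kind, which moreover fails to have maximal regularity. -/
theorem exists_multiplier_of_not_symmetric (hs : ¬ IsSymmetricBasis e) :
    ∃ (A : X →ₗ.[ℂ] X) (T : ℝ → X →L[ℂ] X),
      (∃ (f : SchauderBasis ℂ X) (γ : ℕ → ℝ),
        IsPerturbedBasis e f ∧ (∀ m, 0 < γ m) ∧ IsSchauderMultiplier f γ A) ∧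
      IsSectorial A ∧ sectorialAngle A = 0 ∧ ¬ IsRSectorial A ∧
      IsAnalyticC0Semigroup T ∧ IsGeneratorOf (-A) T ∧ IsPositiveSemigroup (basisCone e) T ∧
      ¬ HasMaximalRegularity A T := by
  suffices main : ∃ (u v : ℕ → ℕ) (huv : IsSplitting u v) (b : ℕ) (hb : b ≤ 1) (c : ℕ → ℂ),
      IsPerturbedBasis e (perturbedBasis he hn huv b hb) ∧ (Summable fun k ↦ c k • e (v k)) ∧
      ¬ Summable fun k ↦ c k • e (u k) by
    obtain ⟨u, v, huv, b, hb, c, hp, hv, hu⟩ := main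
    have hf := hasPairMultipliers_perturbedBasis he hn huv b hb
    exact ⟨multOp (perturbedBasis he hn huv b hb) (rate b),
      fun t : ℝ ↦ expMult (perturbedBasis he hn huv b hb) b t,
      ⟨_, _, hp, rate_pos b, isSchauderMultiplier_multOp _⟩, isSectorial_multOp hb hf,
      sectorialAngle_multOp hb hf, not_isRSectorial he hn huv hb hv hu,
      isAnalyticC0Semigroup_expMult hb hf, isGeneratorOf_expMult hb hf,
      isPositiveSemigroup_expMult he hn huv hb, not_hasMaximalRegularity he hn huv hb hv hu⟩
  obtain ⟨σ, hσ⟩ := exists_perm_not_equivalent he hs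
  have hinj0 : Function.Injective fun k ↦ 2 * k := fun k l h ↦ by simpa using h
  have hinj1 : Function.Injective fun k ↦ 2 * σ k + 1 := fun k l h ↦ by simpa using h
  have hcover : ∀ n, (∃ k, 2 * k = n) ∨ ∃ k, 2 * σ k + 1 = n := fun n ↦ by
    rcases Nat.even_or_odd' n with ⟨k, rfl | rfl⟩
    · exact Or.inl ⟨k, rfl⟩
    · exact Or.inr ⟨σ.symm k, by simp⟩
  rw [EquivalentSeq] at hσ
  push Not at hσ
  obtain ⟨c, hc⟩ := hσ
  rw [seriesConverges_subseq_iff he hinj0, seriesConverges_subseq_iff he hinj1] at hc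
  rcases hc with ⟨h0, h1⟩ | ⟨h0, h1⟩
  · have huv : IsSplitting (fun k ↦ 2 * σ k + 1) (fun k ↦ 2 * k) :=
      ⟨hinj1, hinj0, fun k l ↦ by omega, fun n ↦ (hcover n).symm⟩
    refine ⟨_, _, huv, 1, le_rfl, c, ⟨σ, Or.inr fun k ↦ ⟨?_, ?_⟩⟩, h0, h1⟩
    · rw [add_comm]
      exact perturbedBasis_right he hn huv 1 le_rfl k
    · exact perturbedBasis_left he hn huv 1 le_rfl k
  · have huv : IsSplitting (fun k ↦ 2 * k) (fun k ↦ 2 * σ k + 1) :=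
      ⟨hinj0, hinj1, fun k l ↦ by omega, hcover⟩
    refine ⟨_, _, huv, 0, zero_le_one, c, ⟨σ, Or.inl fun k ↦ ⟨?_, ?_⟩⟩, h1, h0⟩
    · exact perturbedBasis_left he hn huv 0 zero_le_one k
    · exact perturbedBasis_right he hn huv 0 zero_le_one k

end Counterexample

/-! ### Unit vectors of mixed sequence spaces -/

section Mixed

variable {p q : ℝ≥0∞} [Fact (1 ≤ p)] [Fact (1 ≤ q)]

theorem norm_le_norm_of_entries {x y : MixedLp p q} (h : ∀ i j, ‖x i j‖ ≤ ‖y i j‖) :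
    ‖x‖ ≤ ‖y‖ :=
  lp.norm_mono (zero_lt_one.trans_le Fact.out).ne' fun i ↦
    lp.norm_mono (zero_lt_one.trans_le Fact.out).ne' (h i)

theorem mixedUnit_apply (ij : ℕ × ℕ) (i j : ℕ) :
    mixedUnit p q ij i j = if (i, j) = ij then 1 else 0 := by
  obtain ⟨k, l⟩ := ij
  by_cases h1 : i = k
  · subst h1
    by_cases h2 : j = l
    · subst h2; simp [mixedUnit]
    · simp [mixedUnit, h2]
  · simp [mixedUnit, h1]

theorem norm_mixedUnit (ij : ℕ × ℕ) : ‖mixedUnit p q ij‖ = 1 := by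
  rw [mixedUnit, lp.norm_single (zero_lt_one.trans_le Fact.out),
    lp.norm_single (zero_lt_one.trans_le Fact.out), norm_one]

/-- The entry functionals of `ℓ_p(ℓ_q)`. -/
noncomputable def mixedCoord (p q : ℝ≥0∞) [Fact (1 ≤ p)] [Fact (1 ≤ q)] (ij : ℕ × ℕ) :
    StrongDual ℂ (MixedLp p q) :=
  (lp.evalCLM ℂ (fun _ : ℕ ↦ ℂ) q ij.2).comp
    (lp.evalCLM ℂ (fun _ : ℕ ↦ lp (fun _ : ℕ ↦ ℂ) q) p ij.1)

theorem mixedCoord_apply (ij : ℕ × ℕ) (x : MixedLp p q) : mixedCoord p q ij x = x ij.1 ij.2 := rfl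

theorem sum_mixedUnit_apply (s : Finset (ℕ × ℕ)) (a : ℕ × ℕ → ℂ) (i j : ℕ) :
    (∑ ij ∈ s, a ij • mixedUnit p q ij) i j = if (i, j) ∈ s then a (i, j) else 0 := by
  rw [← mixedCoord_apply (i, j), map_sum]
  simp only [map_smul, mixedCoord_apply, mixedUnit_apply, smul_eq_mul, mul_ite, mul_one, mul_zero]
  rw [Finset.sum_ite_eq]

/-- Entrywise domination makes the approximation error decrease with the set of retained entries,
so it is enough to approximate by finite rectangles. -/
theorem hasSum_mixedUnit (hp : p ≠ ∞) (hq : q ≠ ∞) (x : MixedLp p q) :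
    HasSum (fun ij : ℕ × ℕ ↦ x ij.1 ij.2 • mixedUnit p q ij) x := by
  rw [HasSum, Metric.tendsto_nhds]
  intro ε hε
  obtain ⟨I, hI⟩ := (((Metric.tendsto_nhds.1 (lp.hasSum_single hp x)) (ε / 2)
    (by positivity)).exists)
  have hJ : Tendsto (fun J : Finset ℕ ↦ ∑ i ∈ I, ‖∑ j ∈ J, lp.single q j (x i j) - x i‖) atTop
      (𝓝 0) := by
    have h : ∀ i, Tendsto (fun J : Finset ℕ ↦ ‖∑ j ∈ J, lp.single q j (x i j) - x i‖) atTop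
        (𝓝 0) := fun i ↦ by
      have := ((lp.hasSum_single hq (x i)).sub_const (x i)).norm
      simpa using this
    simpa using tendsto_finsetSum I fun i _ ↦ h i
  obtain ⟨J, hJ⟩ := (hJ.eventually_lt_const (show (0 : ℝ) < ε / 2 by positivity)).exists
  have hrect : ∑ ij ∈ I ×ˢ J, x ij.1 ij.2 • mixedUnit p q ij =
      ∑ i ∈ I, lp.single p i (∑ j ∈ J, lp.single q j (x i j)) := by
    rw [Finset.sum_product]
    refine Finset.sum_congr rfl fun i _ ↦ ?_
    rw [← lp.singleContinuousLinearMap_apply (𝕜 := ℂ), map_sum]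
    refine Finset.sum_congr rfl fun j _ ↦ ?_
    rw [lp.singleContinuousLinearMap_apply, mixedUnit, ← lp.single_smul, ← lp.single_smul,
      smul_eq_mul, mul_one]
  have hsmall : ‖∑ ij ∈ I ×ˢ J, x ij.1 ij.2 • mixedUnit p q ij - x‖ < ε := by
    have hsplit : ∑ ij ∈ I ×ˢ J, x ij.1 ij.2 • mixedUnit p q ij - x =
        ∑ i ∈ I, lp.single p i (∑ j ∈ J, lp.single q j (x i j) - x i) +
        (∑ i ∈ I, lp.single p i (x i) - x) := by
      rw [hrect]
      simp only [lp.single_sub, Finset.sum_sub_distrib]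
      abel
    rw [hsplit]
    rw [dist_eq_norm] at hI
    refine (norm_add_le _ _).trans_lt ?_
    have h1 : ‖∑ i ∈ I, lp.single p i (∑ j ∈ J, lp.single q j (x i j) - x i)‖ ≤
        ∑ i ∈ I, ‖∑ j ∈ J, lp.single q j (x i j) - x i‖ := by
      refine (norm_sum_le _ _).trans (Finset.sum_le_sum fun i _ ↦ ?_)
      rw [lp.norm_single (zero_lt_one.trans_le Fact.out)]
    linarith
  filter_upwards [eventually_ge_atTop (I ×ˢ J)] with s hs
  rw [dist_eq_norm]
  refine lt_of_le_of_lt (norm_le_norm_of_entries fun i j ↦ ?_) hsmall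
  rw [← mixedCoord_apply (i, j), ← mixedCoord_apply (i, j), map_sub, map_sub]
  simp only [mixedCoord_apply]
  rw [sum_mixedUnit_apply s fun ij ↦ x ij.1 ij.2, sum_mixedUnit_apply _ fun ij ↦ x ij.1 ij.2]
  by_cases h : (i, j) ∈ I ×ˢ J
  · rw [if_pos h, if_pos (hs h)]
  · rw [if_neg h]
    split_ifs <;> simp

/-- The standard unit vectors of `ℓ_p(ℓ_q)`, enumerated by `ν`, as a Schauder basis. -/
noncomputable def mixedBasis (hp : p ≠ ∞) (hq : q ≠ ∞) (ν : ℕ ≃ ℕ × ℕ) :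
    SchauderBasis ℂ (MixedLp p q) where
  basis n := mixedUnit p q (ν n)
  coord n := mixedCoord p q (ν n)
  ortho i j := by
    have hsingle : (Pi.single j (1 : ℂ) : ℕ → ℂ) i = if i = j then 1 else 0 := by
      simp [Pi.single_apply]
    refine Eq.trans ?_ (hsingle.symm.trans (by congr))
    rw [mixedCoord_apply, mixedUnit_apply]
    simp
  expansion x := hasSum_conditional_of_hasSum (ν.hasSum_iff.2 (hasSum_mixedUnit hp hq x))

variable (hp : p ≠ ∞) (hq : q ≠ ∞) (ν : ℕ ≃ ℕ × ℕ)

theorem isNormalized_mixedBasis : IsNormalized (mixedBasis hp hq ν) := fun n ↦ norm_mixedUnit (ν n)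

theorem isOneUnconditional_mixedBasis : IsOneUnconditional (mixedBasis hp hq ν) := by
  intro s a ε hε
  have hentry : ∀ (a : ℕ → ℂ) (i j : ℕ), (∑ n ∈ s, a n • mixedBasis hp hq ν n) i j =
      if ν.symm (i, j) ∈ s then a (ν.symm (i, j)) else 0 := by
    intro a i j
    have h1 : (∑ n ∈ s, a n • mixedBasis hp hq ν n) i j =
        (mixedBasis hp hq ν).coord (ν.symm (i, j)) (∑ n ∈ s, a n • mixedBasis hp hq ν n) := by
      change _ = mixedCoord p q (ν (ν.symm (i, j))) _
      rw [Equiv.apply_symm_apply, mixedCoord_apply]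
    rw [h1, map_sum, ← Finset.sum_ite_eq s (ν.symm (i, j)) a]
    refine Finset.sum_congr rfl fun n _ ↦ ?_
    rw [map_smul]
    by_cases h : ν.symm (i, j) = n
    · rw [h, coord_self, if_pos rfl, smul_eq_mul, mul_one]
    · rw [coord_ne _ h, if_neg h, smul_zero]
  have hnorm : ∀ i j, ‖(∑ n ∈ s, (ε n * a n) • mixedBasis hp hq ν n) i j‖ =
      ‖(∑ n ∈ s, a n • mixedBasis hp hq ν n) i j‖ := by
    intro i j
    rw [hentry fun n ↦ ε n * a n, hentry a]
    split_ifs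
    · rcases hε (ν.symm (i, j)) with h | h <;> simp [h]
    · rfl
  exact le_antisymm (norm_le_norm_of_entries fun i j ↦ (hnorm i j).le)
    (norm_le_norm_of_entries fun i j ↦ (hnorm i j).ge)

theorem basisCone_mixedBasis : basisCone (mixedBasis hp hq ν) = mixedCone p q := by
  ext x
  refine ⟨fun h i j ↦ ?_, fun h n ↦ h _ _⟩
  have := h (ν.symm (i, j))
  simpa [mixedBasis, mixedCoord_apply] using this

theorem exists_memℓp_not_memℓp {p q : ℝ≥0∞} (hp : 1 ≤ p) (hpq : p < q) (hq : q ≠ ∞) :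
    ∃ α : ℕ → ℂ, Memℓp α q ∧ ¬ Memℓp α p := by
  have hp' : 0 < p.toReal :=
    ENNReal.toReal_pos (zero_lt_one.trans_le hp).ne' (hpq.trans_le le_top).ne
  have hlt : p.toReal < q.toReal := (ENNReal.toReal_lt_toReal (hpq.trans_le le_top).ne hq).2 hpq
  have hnorm : ∀ (r : ℝ) (j : ℕ),
      ‖((((j + 1 : ℕ) : ℝ) ^ (-(1 / p.toReal)) : ℝ) : ℂ)‖ ^ r =
        ((j + 1 : ℕ) : ℝ) ^ (-(r / p.toReal)) := by
    intro r j
    have h0 : (0 : ℝ) ≤ ((j + 1 : ℕ) : ℝ) := by positivity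
    rw [Complex.norm_real, Real.norm_of_nonneg (Real.rpow_nonneg h0 _), ← Real.rpow_mul h0]
    congr 1
    ring
  have hsum : ∀ r : ℝ, (Summable fun j : ℕ ↦ ((j + 1 : ℕ) : ℝ) ^ (-(r / p.toReal))) ↔
      p.toReal < r := by
    intro r
    rw [summable_nat_add_iff 1 (f := fun j : ℕ ↦ (j : ℝ) ^ (-(r / p.toReal))),
      Real.summable_nat_rpow, neg_lt_neg_iff, one_lt_div hp']
  refine ⟨fun j ↦ ((((j + 1 : ℕ) : ℝ) ^ (-(1 / p.toReal)) : ℝ) : ℂ), ?_, ?_⟩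
  · rw [memℓp_gen_iff (hp'.trans hlt)]
    simp only [hnorm]
    exact (hsum _).2 hlt
  · rw [memℓp_gen_iff hp']
    simp only [hnorm]
    exact fun h ↦ lt_irrefl _ ((hsum _).1 h)

/-- Transposition of the index pairs carries the first row, which spans `ℓ_q`, to the first column,
which spans `ℓ_p`. -/
theorem not_isSymmetricBasis_mixedBasis (hpq : p ≠ q) :
    ¬ IsSymmetricBasis (mixedBasis hp hq ν) := by
  intro hsym
  have he := isOneUnconditional_mixedBasis hp hq ν
  let τ : Equiv.Perm ℕ := (ν.trans (Equiv.prodComm ℕ ℕ)).trans ν.symm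
  have hτ : ∀ n, ν (τ n) = (ν n).swap := fun n ↦ by simp [τ]
  have hiff : ∀ α : ℕ → ℂ, Memℓp α p ↔ Memℓp α q := by
    intro α
    let a : ℕ → ℂ := fun n ↦ if (ν n).1 = 0 then α (ν n).2 else 0
    have h := hsym τ a
    rw [seriesConverges_subseq_iff he τ.injective,
      seriesConverges_subseq_iff he (i := fun n ↦ n) Function.injective_id,
      summable_iff_exists_coord_subseq he τ.injective,
      summable_iff_exists_coord_subseq he (i := fun n ↦ n) Function.injective_id] at h
    have hcol : Memℓp α p ↔ ∃ x : MixedLp p q, ∀ n, (mixedBasis hp hq ν).coord (τ n) x = a n := by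
      constructor
      · intro hα
        have hmem : Memℓp (fun i ↦ lp.single q 0 (α i) : ℕ → lp (fun _ : ℕ ↦ ℂ) q) p :=
          hα.mono' fun i ↦ by
            rw [lp.norm_single (zero_lt_one.trans_le Fact.out)]
        refine ⟨⟨_, hmem⟩, fun n ↦ ?_⟩
        change mixedCoord p q (ν (τ n)) _ = _
        rw [hτ, mixedCoord_apply]
        change (lp.single q 0 (α (ν n).2) : lp (fun _ : ℕ ↦ ℂ) q) (ν n).1 = _
        by_cases h0 : (ν n).1 = 0
        · simp [a, h0]
        · simp [a, h0]
      · rintro ⟨x, hx⟩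
        refine (lp.memℓp x).mono' fun i ↦ ?_
        have := hx (ν.symm (0, i))
        change mixedCoord p q (ν (τ _)) x = _ at this
        rw [hτ, mixedCoord_apply] at this
        simp only [a, Equiv.apply_symm_apply, if_true, Prod.swap_prod_mk] at this
        rw [← this]
        exact lp.norm_apply_le_norm (zero_lt_one.trans_le Fact.out).ne' _ _
    have hrow : Memℓp α q ↔ ∃ x : MixedLp p q, ∀ n, (mixedBasis hp hq ν).coord n x = a n := by
      constructor
      · intro hα
        refine ⟨lp.single p 0 ⟨α, hα⟩, fun n ↦ ?_⟩
        change mixedCoord p q (ν n) _ = _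
        rw [mixedCoord_apply]
        by_cases h0 : (ν n).1 = 0
        · simp [a, h0]
        · simp [a, h0]
      · rintro ⟨x, hx⟩
        refine (lp.memℓp (x 0)).mono' fun j ↦ ?_
        have := hx (ν.symm (0, j))
        change mixedCoord p q (ν _) x = _ at this
        rw [mixedCoord_apply] at this
        simp only [a, Equiv.apply_symm_apply, if_true] at this
        rw [← this]
    rw [hcol, hrow, h]
  rcases lt_or_gt_of_ne hpq with hlt | hlt
  · obtain ⟨α, h1, h2⟩ := exists_memℓp_not_memℓp Fact.out hlt hq
    exact h2 ((hiff α).2 h1)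
  · obtain ⟨α, h1, h2⟩ := exists_memℓp_not_memℓp Fact.out hlt hp
    exact h2 ((hiff α).1 h1)

end Mixed

end PositiveMR

/-! ### Existence of the multipliers -/

theorem mainTheorem2 :
    (∀ (X : Type*) [NormedAddCommGroup X] [NormedSpace ℂ X] [CompleteSpace X]
      (e : SchauderBasis ℂ X),
      IsNormalized e → IsOneUnconditional e → ¬ IsSymmetricBasis e →
      ∃ (A : X →ₗ.[ℂ] X) (T : ℝ → X →L[ℂ] X),
        (∃ (f : SchauderBasis ℂ X) (γ : ℕ → ℝ),
          IsPerturbedBasis e f ∧ (∀ m, 0 < γ m) ∧ IsSchauderMultiplier f γ A) ∧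
        IsSectorial A ∧ sectorialAngle A = 0 ∧ ¬ IsRSectorial A ∧
        IsAnalyticC0Semigroup T ∧ IsGeneratorOf (-A) T ∧ IsPositiveSemigroup (basisCone e) T) ∧
    (∀ (p q : ℝ≥0∞) [Fact (1 ≤ p)] [Fact (1 ≤ q)],
      1 < p → p < ∞ → 1 < q → q < ∞ → p ≠ q →
      ∀ ν : ℕ ≃ ℕ × ℕ, ∃ e : SchauderBasis ℂ (MixedLp p q),
        (∀ n, e n = mixedUnit p q (ν n)) ∧
        IsNormalized e ∧ IsOneUnconditional e ∧ ¬ IsSymmetricBasis e ∧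
        basisCone e = mixedCone p q ∧
        ∃ (A : MixedLp p q →ₗ.[ℂ] MixedLp p q) (T : ℝ → MixedLp p q →L[ℂ] MixedLp p q),
          (∃ (f : SchauderBasis ℂ (MixedLp p q)) (γ : ℕ → ℝ),
            IsPerturbedBasis e f ∧ (∀ m, 0 < γ m) ∧ IsSchauderMultiplier f γ A) ∧
          IsSectorial A ∧ sectorialAngle A = 0 ∧ ¬ IsRSectorial A ∧
          IsAnalyticC0Semigroup T ∧ IsGeneratorOf (-A) T ∧
          IsPositiveSemigroup (mixedCone p q) T ∧ ¬ HasMaximalRegularity A T) := by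
  refine ⟨fun X _ _ _ e hn he hs ↦ ?_, fun p q _ _ hp1 hp hq1 hq hpq ν ↦ ?_⟩
  · obtain ⟨A, T, h1, h2, h3, h4, h5, h6, h7, -⟩ := exists_multiplier_of_not_symmetric he hn hs
    exact ⟨A, T, h1, h2, h3, h4, h5, h6, h7⟩
  · have hn := isNormalized_mixedBasis hp.ne hq.ne ν
    have he := isOneUnconditional_mixedBasis hp.ne hq.ne ν
    have hs := not_isSymmetricBasis_mixedBasis hp.ne hq.ne ν hpq
    have hcone := basisCone_mixedBasis hp.ne hq.ne ν
    refine ⟨mixedBasis hp.ne hq.ne ν, fun n ↦ rfl, hn, he, hs, hcone, ?_⟩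
    rw [← hcone]
    exact exists_multiplier_of_not_symmetric he hn hs
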